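/- Let $n\ge 4$ and let $X_n=\{1<2<\cdots<n\}$. Maps are written on the right, so $x(\alpha\beta)=(x\alpha)\beta$. A map $\alpha:X_n\to X_n$ is *order-decreasing* if $a\alpha\le a$ for all $a$; it is *orientation-preserving* (resp. *orientation-reversing*) if there is at most one $i\in X_n$ with $(i+1)\alpha<i\alpha$ (resp. $i\alpha<(i+1)\alpha$), where $(n+1)\alpha$ means $1\alpha$; it is *oriented* if it is orientation-preserving or orientation-reversing. Let $\mathcal{OPD}_n$ (resp. $\mathcal{ORD}_n$) be the semigroup under composition of all orientation-preserving (resp. oriented) order-decreasing maps $X_n\to X_n$, and let $\mathcal{ORD}(n,r)=\{\alpha\in\mathcal{ORD}_n:|\mathrm{im}(\alpha)|\le r\}$. The *rank* of a finite semigroup is the least size of a non-empty subset that generates it as a semigroup, and a *minimal generating set* is a generating set whose size is the rank. Let $3\le r\le n-1$. For $\alpha\in\mathcal{OPD}_n$ let $\mathrm{opd}(\alpha)$ be the largest $m\le n$ such that $\alpha$ restricted to $\{1,\dots,m\}$ is order-preserving, i.e. $a\alpha\le b\alpha$ whenever $a<b\le m$. For $r+1\le m\le n$ let $B_m$ be the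 set of idempotents $\alpha\in\mathcal{OPD}_n$ with $|\mathrm{im}(\alpha)|=r$ and $\mathrm{opd}(\alpha)=m$. For $2\le m\le r$ let $\rho_m$ be the map that fixes $1,\dots,m$ and sends $m+1,\dots,n$ to $1$. Put $$C=\Big(\bigcup_{m=r+1}^{n}B_m\Big)\cup\{\rho_2,\dots,\rho_r\}.$$ Let $\hat r=\min\{r,\lceil (n+1)/2\rceil\}$. For $3\le m\le n-1$ define $\lambda_{m,\hat r}:X_n\to X_n$ as follows. If $m\le n-\hat r+1$, put $p=\max\{0,m-\hat r\}$ and let $x\lambda_{m,\hat r}=2m-x$ for $m\le x\le 2m-p-2$ and $x\lambda_{m,\hat r}=1$ for all other $x$. If $m\ge n-\hat r+2$, let $x\lambda_{m,\hat r}=2m-x$ for $m\le x\le n$ and $x\lambda_{m,\hat r}=1$ for $x<m$. Put $G_{n,\hat r}=\{\lambda_{m,\hat r}:3\le m\le n-1\}$. Then, for every $3\le r\le n-1$, the set $C\cup G_{n,\hat r}$ is a minimal generating set of $\mathcal{ORD}(n,r)$, and $\mathrm{rank}(\mathcal{ORD}(n,r))=\binom{n}{r}+n+r-5$. Moreover,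 $\mathrm{rank}(\mathcal{ORD}_n)=3n-5$. -/

import Mathlib

namespace Transf

/-- The finite chain `X_n = {1 < 2 < ⋯ < n}`. -/
abbrev X (n : ℕ) : Type := Set.Icc 1 n

/-- Full transformations of the chain `X_n`; the image of `x` under `α` is `α x`. -/
def T (n : ℕ) : Type := X n → X n

/-- The full transformation semigroup. Maps act on the right: `x(αβ) = (xα)β`. -/
instance (n : ℕ) : Semigroup (T n) where
  mul α β := fun x => β (α x)
  mul_assoc _ _ _ := rfl

variable {n : ℕ}

/-- The cyclic successor: `i ↦ i + 1` for `i < n`, and `n ↦ 1`. -/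
def next (i : X n) : X n :=
  if h : i.1 < n then ⟨i.1 + 1, Nat.le_add_left 1 i.1, h⟩ else ⟨1, le_rfl, i.2.1.trans i.2.2⟩

/-- `a < b` implies `aα ≤ bα`, for `a`, `b` in the initial segment `{1, …, m}`. -/
def OrderPreservingUpTo (m : ℕ) (α : T n) : Prop :=
  ∀ a b : X n, a < b → b.1 ≤ m → α a ≤ α b

/-- `aα ≤ a` for all `a`. -/
def OrderDecreasing (α : T n) : Prop := ∀ a : X n, α a ≤ a

/-- The sequence `(1α, …, nα)` is cyclic: at most one `i` has `(i+1)α < iα`. -/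
def OrientationPreserving (α : T n) : Prop := {i : X n | α (next i) < α i}.Subsingleton

/-- The sequence `(1α, …, nα)` is anti-cyclic: at most one `i` has `iα < (i+1)α`. -/
def OrientationReversing (α : T n) : Prop := {i : X n | α i < α (next i)}.Subsingleton

/-- The size of the image of `α`. -/
noncomputable def height (α : T n) : ℕ := (Set.range (fun x : X n => α x)).ncard

/-- Orientation-preserving and order-decreasing full transformations. -/
def OPDn (n : ℕ) : Set (T n) := {α | OrientationPreserving α ∧ OrderDecreasing α}

/-- Oriented and order-decreasing full transformations. -/
def ORDn (n : ℕ) : Set (T n) :=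
  {α | (OrientationPreserving α ∨ OrientationReversing α) ∧ OrderDecreasing α}

/-- The elements of `ORD_n` with at most `r` image points. -/
def ORD (n r : ℕ) : Set (T n) := {α ∈ ORDn n | height α ≤ r}

/-- `A` is a generating set of `S`: `A` is non-empty and the smallest subsemigroup containing `A`
is `S` (so in particular `S` is a subsemigroup and `A ⊆ S`). -/
def IsGeneratingSet (A S : Set (T n)) : Prop :=
  A.Nonempty ∧ (Subsemigroup.closure A : Set (T n)) = S

/-- The rank of a subsemigroup `S` of the (finite) semigroup `T n`: the least size of a
generating set. -/
noncomputable def rank (S : Set (T n)) : ℕ :=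
  sInf {k | ∃ A : Set (T n), IsGeneratingSet A S ∧ A.ncard = k}

/-- A minimal generating set is a generating set whose size is the rank. -/
def IsMinimalGeneratingSet (A S : Set (T n)) : Prop :=
  IsGeneratingSet A S ∧ A.ncard = rank S

/-- The order-preserving degree: the largest `m` such that `α` restricted to `{1, …, m}` is
order-preserving. -/
noncomputable def opd (α : T n) : ℕ := sSup {m | m ≤ n ∧ OrderPreservingUpTo m α}

/-- The idempotents of height `r` and order-preserving degree `m` in `OPD_n`. -/
def B (n r m : ℕ) : Set (T n) := {α ∈ OPDn n | α * α = α ∧ height α = r ∧ opd α = m}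

/-- `ρ_m` fixes `1, …, m` and sends `m + 1, …, n` to `1`. -/
def rho (n m : ℕ) : T n := fun x =>
  if x.1 ≤ m then x else ⟨1, le_rfl, x.2.1.trans x.2.2⟩

/-- The set `C = B_{r+1} ∪ ⋯ ∪ B_n ∪ {ρ_2, …, ρ_r}`. -/
def C (n r : ℕ) : Set (T n) :=
  (⋃ m ∈ Set.Icc (r + 1) n, B n r m) ∪ {α | ∃ m ∈ Set.Icc 2 r, α = rho n m}

/-- `λ_{m,r}`, used for `3 ≤ r ≤ ⌈(n+1)/2⌉` and `3 ≤ m ≤ n - 1`.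
If `m ≤ n - r + 1`, then with `p = max {0, m - r}` (here truncated subtraction), `x ↦ 2m - x` for
`m ≤ x ≤ 2m - p - 2` and all other points go to `1`.
If `m ≥ n - r + 2`, then `x ↦ 2m - x` for `m ≤ x ≤ n` and all other points go to `1`; the extra
condition `x < 2m` only makes the definition total, as `n < 2m` in the stated range. -/
def lam (n r m : ℕ) : T n := fun x =>
  if m + r ≤ n + 1 then
    if h : m ≤ x.1 ∧ x.1 + (m - r) + 2 ≤ 2 * m then
      ⟨2 * m - x.1, by have := x.2.2; constructor <;> omega⟩
    else ⟨1, le_rfl, x.2.1.trans x.2.2⟩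
  else
    if h : m ≤ x.1 ∧ x.1 < 2 * m then
      ⟨2 * m - x.1, by have := x.2.2; constructor <;> omega⟩
    else ⟨1, le_rfl, x.2.1.trans x.2.2⟩

/-- `r̂ = min {r, ⌈(n+1)/2⌉}`; note `⌈(n+1)/2⌉ = ⌊(n+2)/2⌋`. -/
def rhat (n r : ℕ) : ℕ := min r ((n + 2) / 2)

/-- `G_{n,r̂} = {λ_{m,r̂} : 3 ≤ m ≤ n - 1}`. -/
def G (n r : ℕ) : Set (T n) := {α | ∃ m ∈ Set.Icc 3 (n - 1), α = lam n (rhat n r) m}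

end Transf

/-! An order-decreasing map fixes `1`. So orientation-preserving means that the values increase and
are `1` from some point on (`PForm`), and orientation-reversing means that they are `1` up to some
point and decrease afterwards (`QForm`).

Generation. A preserving map whose cut exceeds `r` is a product of retractions in one `B n r m`
(`mem_closure_B`, by induction on total displacement). A smaller cut needs one factor `rho n m` in
front. A map that is reversing only factors as `ε * λ_m * γ`, with `ε` and `γ` preserving and `m`
the first point not sent to `1` (`QForm.mem_closure`).

Lower bound. Each element of `C n r` equals one of the factors in any factorization of it within
`ORD n r`, so it lies in every generating set. For `3 ≤ m < n`, a product in `Refl n m` has a factor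
in `Refl n m`. These sets are pairwise disjoint and miss `C n r`, so they cost `n - 3` further
generators, which the maps `λ_m` provide. Counting retractions by degree and image gives the
formula. Passing to `ORDn n` adds just the identity. -/

namespace Transf

/-! ### Oriented decreasing maps as value patterns -/

variable {n : ℕ}

/-- The transformation `α` read as a function on natural numbers, with value `0` off `X_n`. -/
def val (α : T n) (x : ℕ) : ℕ := if h : x ∈ Set.Icc 1 n then (α ⟨x, h⟩).1 else 0

theorem coe_apply (α : T n) (x : X n) : (α x).1 = val α x.1 := by
  have h : x.1 ∈ Set.Icc 1 n := x.2
  simp only [val, dif_pos h]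

theorem val_of_mem (α : T n) {x : ℕ} (h1 : 1 ≤ x) (h2 : x ≤ n) : val α x = (α ⟨x, h1, h2⟩).1 :=
  (coe_apply α ⟨x, h1, h2⟩).symm

theorem one_le_val (α : T n) {x : ℕ} (h1 : 1 ≤ x) (h2 : x ≤ n) : 1 ≤ val α x := by
  rw [val_of_mem α h1 h2]; exact (α _).2.1

theorem val_le_top (α : T n) {x : ℕ} (h1 : 1 ≤ x) (h2 : x ≤ n) : val α x ≤ n := by
  rw [val_of_mem α h1 h2]; exact (α _).2.2

theorem mul_apply (α β : T n) (x : X n) : (α * β) x = β (α x) := rfl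

theorem val_mul (α β : T n) {x : ℕ} (h1 : 1 ≤ x) (h2 : x ≤ n) :
    val (α * β) x = val β (val α x) := by
  rw [val_of_mem _ h1 h2, mul_apply, coe_apply, coe_apply]

theorem ext_val {α β : T n} (h : ∀ x, 1 ≤ x → x ≤ n → val α x = val β x) : α = β := by
  funext x
  apply Subtype.ext
  rw [coe_apply, coe_apply]
  exact h _ x.2.1 x.2.2

/-- The order-decreasing property in terms of `val`. -/
def Dec (α : T n) : Prop := ∀ x, 1 ≤ x → x ≤ n → val α x ≤ x

theorem orderDecreasing_iff (α : T n) : OrderDecreasing α ↔ Dec α := by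
  constructor
  · intro h x h1 h2
    rw [val_of_mem α h1 h2]
    exact h ⟨x, h1, h2⟩
  · intro h a
    change (α a).1 ≤ a.1
    rw [coe_apply]
    exact h _ a.2.1 a.2.2

theorem Dec.val_one {α : T n} (h : Dec α) (hn : 1 ≤ n) : val α 1 = 1 :=
  le_antisymm (h 1 le_rfl hn) (one_le_val α le_rfl hn)

theorem Dec.mul {α β : T n} (ha : Dec α) (hb : Dec β) : Dec (α * β) := by
  intro x h1 h2
  rw [val_mul _ _ h1 h2]
  exact (hb _ (one_le_val α h1 h2) (val_le_top α h1 h2)).trans (ha x h1 h2)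

/-- The values increase up to some point and are `1` afterwards. -/
def PForm (α : T n) : Prop :=
  ∀ x y z, 1 ≤ x → x ≤ y → y ≤ z → z ≤ n → val α x ≤ val α y ∨ val α z = 1

/-- The values are `1` up to some point and decrease afterwards. -/
def QForm (α : T n) : Prop :=
  ∀ x y z, 1 ≤ x → x ≤ y → y ≤ z → z ≤ n → val α x = 1 ∨ val α z ≤ val α y

theorem coe_next (α : T n) (i : X n) :
    (α (next i)).1 = val α (if i.1 < n then i.1 + 1 else 1) := by
  rw [coe_apply]
  congr 1
  unfold next
  split_ifs <;> rfl

/-- Of two positions only the larger can be `n`, so only `j` needs the cyclic wrap-around. -/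
theorem orientationPreserving_iff_val (α : T n) : OrientationPreserving α ↔
    ∀ i j, 1 ≤ i → i < j → j ≤ n → val α (i + 1) < val α i →
      ¬ val α (if j < n then j + 1 else 1) < val α j := by
  constructor
  · intro h i j h1 hij hj hi hj'
    have a1 : (⟨i, h1, by omega⟩ : X n) ∈ {i : X n | α (next i) < α i} := by
      change (α (next ⟨i, h1, by omega⟩)).1 < (α ⟨i, h1, by omega⟩).1
      rw [coe_next, if_pos (show i < n by omega), coe_apply]; exact hi
    have a2 : (⟨j, by omega, hj⟩ : X n) ∈ {i : X n | α (next i) < α i} := by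
      change (α (next ⟨j, by omega, hj⟩)).1 < (α ⟨j, by omega, hj⟩).1
      rw [coe_next, coe_apply]; exact hj'
    have := congrArg Subtype.val (h a1 a2)
    simp only at this
    omega
  · intro h
    have key : ∀ a b : X n, α (next a) < α a → α (next b) < α b → ¬ a.1 < b.1 := by
      intro a b ha hb hab
      have ha' : (α (next a)).1 < (α a).1 := ha
      have hb' : (α (next b)).1 < (α b).1 := hb
      have hbn : b.1 ≤ n := b.2.2
      rw [coe_next, if_pos (by omega), coe_apply] at ha'
      rw [coe_next, coe_apply] at hb'
      exact h a.1 b.1 a.2.1 hab hbn ha' hb'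
    intro a ha b hb
    apply Subtype.ext
    have h1 := key a b ha hb
    have h2 := key b a hb ha
    omega

theorem orientationReversing_iff_val (α : T n) : OrientationReversing α ↔
    ∀ i j, 1 ≤ i → i < j → j ≤ n → val α i < val α (i + 1) →
      ¬ val α j < val α (if j < n then j + 1 else 1) := by
  constructor
  · intro h i j h1 hij hj hi hj'
    have a1 : (⟨i, h1, by omega⟩ : X n) ∈ {i : X n | α i < α (next i)} := by
      change (α ⟨i, h1, by omega⟩).1 < (α (next ⟨i, h1, by omega⟩)).1
      rw [coe_next, if_pos (show i < n by omega), coe_apply]; exact hi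
    have a2 : (⟨j, by omega, hj⟩ : X n) ∈ {i : X n | α i < α (next i)} := by
      change (α ⟨j, by omega, hj⟩).1 < (α (next ⟨j, by omega, hj⟩)).1
      rw [coe_next, coe_apply]; exact hj'
    have := congrArg Subtype.val (h a1 a2)
    simp only at this
    omega
  · intro h
    have key : ∀ a b : X n, α a < α (next a) → α b < α (next b) → ¬ a.1 < b.1 := by
      intro a b ha hb hab
      have ha' : (α a).1 < (α (next a)).1 := ha
      have hb' : (α b).1 < (α (next b)).1 := hb
      have hbn : b.1 ≤ n := b.2.2
      rw [coe_next, if_pos (by omega), coe_apply] at ha'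
      rw [coe_next, coe_apply] at hb'
      exact h a.1 b.1 a.2.1 hab hbn ha' hb'
    intro a ha b hb
    apply Subtype.ext
    have h1 := key a b ha hb
    have h2 := key b a hb ha
    omega

theorem exists_descent {f : ℕ → ℕ} {x y : ℕ} (hxy : x ≤ y) (h : f y < f x) :
    ∃ i, x ≤ i ∧ i < y ∧ f (i + 1) < f i := by
  induction y, hxy using Nat.le_induction with
  | base => omega
  | succ k hk ih =>
    by_cases h' : f (k + 1) < f k
    · exact ⟨k, hk, by omega, h'⟩
    · obtain ⟨i, a, b, c⟩ := ih (by omega)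
      exact ⟨i, a, by omega, c⟩

theorem exists_ascent {f : ℕ → ℕ} {x y : ℕ} (hxy : x ≤ y) (h : f x < f y) :
    ∃ i, x ≤ i ∧ i < y ∧ f i < f (i + 1) := by
  induction y, hxy using Nat.le_induction with
  | base => omega
  | succ k hk ih =>
    by_cases h' : f k < f (k + 1)
    · exact ⟨k, hk, by omega, h'⟩
    · obtain ⟨i, a, b, c⟩ := ih (by omega)
      exact ⟨i, a, by omega, c⟩

/-- The cyclic sequence returns to the value `1` at the point `1`. After a descent between `x` and
`y`, a value above `1` at `z` forces a second descent, either before `n` or at the wrap-around. -/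
theorem orientationPreserving_iff {α : T n} (hd : Dec α) :
    OrientationPreserving α ↔ PForm α := by
  rw [orientationPreserving_iff_val]
  constructor
  · intro h x y z hx hxy hyz hz
    by_contra! hc
    obtain ⟨i, i1, i2, i3⟩ := exists_descent hxy hc.1
    have hz1 := one_le_val α (by omega : 1 ≤ z) hz
    by_cases hzn : val α n < val α z
    · obtain ⟨j, j1, j2, j3⟩ := exists_descent hz hzn
      refine h i j (by omega) (by omega) (by omega) i3 ?_
      rwa [if_pos j2]
    · refine h i n (by omega) (by omega) le_rfl i3 ?_
      rw [if_neg (lt_irrefl n), hd.val_one (by omega)]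
      have := hc.2
      omega
  · intro h i j h1 hij hj hi hj'
    rcases h i (i + 1) j h1 (by omega) (by omega) hj with h' | h'
    · omega
    · have : 1 ≤ val α (if j < n then j + 1 else 1) := by
        apply one_le_val <;> split_ifs <;> omega
      omega

/-- The wrap-around is never an ascent, since it ends in the minimum `1`. A value above `1` at `x`
forces an ascent before `x`, which excludes any later one. -/
theorem orientationReversing_iff {α : T n} (hd : Dec α) :
    OrientationReversing α ↔ QForm α := by
  rw [orientationReversing_iff_val]
  constructor
  · intro h x y z hx hxy hyz hz
    by_contra! hc
    have hx1 := one_le_val α hx (by omega)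
    have h1 := hd.val_one (by omega)
    obtain ⟨i, i1, i2, i3⟩ := exists_ascent (f := val α) hx (by have := hc.1; omega)
    obtain ⟨j, j1, j2, j3⟩ := exists_ascent hyz hc.2
    refine h i j (by omega) (by omega) (by omega) i3 ?_
    rwa [if_pos (by omega)]
  · intro h i j h1 hij hj hi hj'
    have hi1 := one_le_val α h1 (by omega)
    split_ifs at hj' with hjn
    · rcases h (i + 1) j (j + 1) (by omega) (by omega) (by omega) (by omega) with h' | h' <;> omega
    · have := hd.val_one (by omega)
      have := one_le_val α (by omega : 1 ≤ j) hj
      omega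

theorem mem_OPDn_iff {α : T n} : α ∈ OPDn n ↔ PForm α ∧ Dec α := by
  constructor
  · rintro ⟨h, hd⟩
    rw [orderDecreasing_iff] at hd
    exact ⟨(orientationPreserving_iff hd).1 h, hd⟩
  · rintro ⟨h, hd⟩
    exact ⟨(orientationPreserving_iff hd).2 h, (orderDecreasing_iff α).2 hd⟩

theorem mem_ORDn_iff {α : T n} : α ∈ ORDn n ↔ (PForm α ∨ QForm α) ∧ Dec α := by
  constructor
  · rintro ⟨h, hd⟩
    rw [orderDecreasing_iff] at hd
    rw [orientationPreserving_iff hd, orientationReversing_iff hd] at h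
    exact ⟨h, hd⟩
  · rintro ⟨h, hd⟩
    refine ⟨?_, (orderDecreasing_iff α).2 hd⟩
    rwa [orientationPreserving_iff hd, orientationReversing_iff hd]

/-! ### Products of preserving and reversing maps -/

section mul
variable {α β : T n}

/-- Unless `α` sends `z` to `1`, it keeps the triple `x ≤ y ≤ z` in order, and the form of `β`
applies to the image triple. For `α` reversing, the triple is reversed unless `x` goes to `1`. -/
theorem PForm.mul_p (ha : PForm α) (hb : PForm β) (db : Dec β) : PForm (α * β) := by
  intro x y z hx hxy hyz hz
  have h1 := db.val_one (by omega)
  rw [val_mul _ _ hx (by omega), val_mul _ _ (by omega) (by omega : y ≤ n),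
    val_mul _ _ (by omega) hz]
  have a1 := ha x y z hx hxy hyz hz
  have a2 := ha y z z (by omega) hyz le_rfl hz
  by_cases hz1 : val α z = 1
  · right; rw [hz1, h1]
  · exact hb _ _ _ (one_le_val α hx (by omega)) (by tauto) (by tauto)
      (val_le_top α (by omega) hz)

theorem PForm.mul_q (ha : PForm α) (hb : QForm β) (db : Dec β) : QForm (α * β) := by
  intro x y z hx hxy hyz hz
  have h1 := db.val_one (by omega)
  rw [val_mul _ _ hx (by omega), val_mul _ _ (by omega) (by omega : y ≤ n),
    val_mul _ _ (by omega) hz]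
  have a1 := ha x y z hx hxy hyz hz
  have a2 := ha y z z (by omega) hyz le_rfl hz
  by_cases hz1 : val α z = 1
  · right; rw [hz1, h1]
    exact one_le_val _ (one_le_val α (by omega) (by omega)) (val_le_top α (by omega) (by omega))
  · exact hb _ _ _ (one_le_val α hx (by omega)) (by tauto) (by tauto)
      (val_le_top α (by omega) hz)

theorem QForm.mul_p (ha : QForm α) (hb : PForm β) (db : Dec β) : QForm (α * β) := by
  intro x y z hx hxy hyz hz
  have h1 := db.val_one (by omega)
  rw [val_mul _ _ hx (by omega), val_mul _ _ (by omega) (by omega : y ≤ n),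
    val_mul _ _ (by omega) hz]
  have a1 := ha x y z hx hxy hyz hz
  have a2 := ha x x y hx le_rfl hxy (by omega)
  by_cases hx1 : val α x = 1
  · left; rw [hx1, h1]
  · exact (hb _ _ _ (one_le_val α (by omega) (by omega)) (by tauto) (by tauto)
      (val_le_top α (by omega) (by omega))).symm

theorem QForm.mul_q (ha : QForm α) (hb : QForm β) (db : Dec β) : PForm (α * β) := by
  intro x y z hx hxy hyz hz
  have h1 := db.val_one (by omega)
  rw [val_mul _ _ hx (by omega), val_mul _ _ (by omega) (by omega : y ≤ n),
    val_mul _ _ (by omega) hz]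
  have a1 := ha x y z hx hxy hyz hz
  have a2 := ha x x y hx le_rfl hxy (by omega)
  by_cases hx1 : val α x = 1
  · left; rw [hx1, h1]
    exact one_le_val _ (one_le_val α (by omega) (by omega)) (val_le_top α (by omega) (by omega))
  · exact (hb _ _ _ (one_le_val α (by omega) (by omega)) (by tauto) (by tauto)
      (val_le_top α (by omega) (by omega))).symm

theorem mul_mem_ORDn (ha : α ∈ ORDn n) (hb : β ∈ ORDn n) : α * β ∈ ORDn n := by
  rw [mem_ORDn_iff] at *
  refine ⟨?_, ha.2.mul hb.2⟩
  rcases ha.1 with p | p <;> rcases hb.1 with q | q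
  · exact .inl (p.mul_p q hb.2)
  · exact .inr (p.mul_q q hb.2)
  · exact .inr (p.mul_p q hb.2)
  · exact .inl (p.mul_q q hb.2)

end mul

/-! ### Images and heights -/

/-- The image of `α` as a finite set of natural numbers. -/
def img (α : T n) : Finset ℕ := (Finset.Icc 1 n).image (val α)

theorem mem_img {α : T n} {y : ℕ} : y ∈ img α ↔ ∃ x, 1 ≤ x ∧ x ≤ n ∧ val α x = y := by
  simp [img, and_assoc]

theorem val_mem_img (α : T n) {x : ℕ} (h1 : 1 ≤ x) (h2 : x ≤ n) : val α x ∈ img α :=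
  mem_img.2 ⟨x, h1, h2, rfl⟩

theorem height_eq (α : T n) : height α = (img α).card := by
  unfold height
  rw [← Set.ncard_image_of_injective _ Subtype.val_injective, ← Set.ncard_coe_finset]
  congr 1
  ext y
  simp only [Set.mem_image, Set.mem_range, Finset.mem_coe, mem_img]
  constructor
  · rintro ⟨_, ⟨x, rfl⟩, rfl⟩
    exact ⟨x.1, x.2.1, x.2.2, (coe_apply α x).symm⟩
  · rintro ⟨x, h1, h2, rfl⟩
    exact ⟨_, ⟨⟨x, h1, h2⟩, rfl⟩, coe_apply α _⟩

theorem img_mul (α β : T n) : img (α * β) = (img α).image (val β) := by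
  ext y
  simp only [Finset.mem_image, mem_img]
  constructor
  · rintro ⟨x, h1, h2, rfl⟩
    exact ⟨_, ⟨x, h1, h2, rfl⟩, (val_mul _ _ h1 h2).symm⟩
  · rintro ⟨_, ⟨x, h1, h2, rfl⟩, rfl⟩
    exact ⟨x, h1, h2, val_mul _ _ h1 h2⟩

theorem height_mul_le_left (α β : T n) : height (α * β) ≤ height α := by
  rw [height_eq, height_eq, img_mul]
  exact Finset.card_image_le

theorem mem_ORD_iff {r : ℕ} {α : T n} :
    α ∈ ORD n r ↔ (PForm α ∨ QForm α) ∧ Dec α ∧ (img α).card ≤ r := by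
  rw [← height_eq, ← and_assoc, ← mem_ORDn_iff]; rfl

/-- `ORD(n, r)` as a subsemigroup. -/
def ordSubsemigroup (n r : ℕ) : Subsemigroup (T n) where
  carrier := ORD n r
  mul_mem' ha hb := ⟨mul_mem_ORDn ha.1 hb.1, (height_mul_le_left _ _).trans ha.2⟩

/-! ### Retractions onto subsets -/

/-- The order-decreasing transformation obtained from `f` by truncating its values. -/
def mk (n : ℕ) (f : ℕ → ℕ) : T n := fun x =>
  ⟨max 1 (min (f x.1) x.1), by
    have h1 : 1 ≤ x.1 := x.2.1
    have h2 : x.1 ≤ n := x.2.2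
    constructor <;> omega⟩

theorem val_mk_eq (f : ℕ → ℕ) {x : ℕ} (h1 : 1 ≤ x) (h2 : x ≤ n) :
    val (mk n f) x = max 1 (min (f x) x) := by
  rw [val_of_mem _ h1 h2]; rfl

theorem val_mk (f : ℕ → ℕ) {x : ℕ} (h1 : 1 ≤ x) (h2 : x ≤ n) (h3 : 1 ≤ f x) (h4 : f x ≤ x) :
    val (mk n f) x = f x := by
  rw [val_mk_eq f h1 h2]; omega

theorem dec_mk (f : ℕ → ℕ) : Dec (mk n f) := by
  intro x h1 h2
  rw [val_mk_eq f h1 h2]; omega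

/-- On `{1, …, m}` the retraction onto `{1} ∪ I` sending `x` to the largest point below `x`;
all points above `m` are sent to `1`. -/
def idem (n m : ℕ) (I : Finset ℕ) : T n :=
  mk n fun x => if x ≤ m then (I.filter (· ≤ x)).sup id else 1

theorem val_idem_of_lt (m : ℕ) (I : Finset ℕ) {x : ℕ} (h1 : m < x) (h2 : x ≤ n) :
    val (idem n m I) x = 1 := by
  unfold idem
  rw [val_mk_eq _ (by omega) h2, if_neg (by omega)]
  omega

theorem val_idem_spec (m : ℕ) (I : Finset ℕ) {x : ℕ} (h1 : 1 ≤ x) (hm : x ≤ m) (h2 : x ≤ n) :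
    (val (idem n m I) x = 1 ∨ val (idem n m I) x ∈ I) ∧ val (idem n m I) x ≤ x ∧
      ∀ z ∈ I, z ≤ x → z ≤ val (idem n m I) x := by
  have hle : (I.filter (· ≤ x)).sup id ≤ x :=
    Finset.sup_le fun z hz => (Finset.mem_filter.1 hz).2
  have hv : val (idem n m I) x = max 1 ((I.filter (· ≤ x)).sup id) := by
    unfold idem
    rw [val_mk_eq _ h1 h2, if_pos hm, min_eq_left hle]
  rw [hv]
  refine ⟨?_, by omega, fun z hz hzx => ?_⟩
  · rcases (I.filter (· ≤ x)).eq_empty_or_nonempty with h | h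
    · left; rw [h]; rfl
    · obtain ⟨y, hy, hy'⟩ := Finset.exists_mem_eq_sup _ h id
      rw [hy']
      have := (Finset.mem_filter.1 hy).1
      by_cases h0 : 1 ≤ y
      · right; simpa [h0] using this
      · left; simp only [id]; omega
  · have : z ≤ (I.filter (· ≤ x)).sup id :=
      Finset.le_sup (f := id) (Finset.mem_filter.2 ⟨hz, hzx⟩)
    omega

theorem val_idem_eq {m : ℕ} {I : Finset ℕ} (hI : ∀ z ∈ I, 1 ≤ z) {x y : ℕ} (h1 : 1 ≤ x)
    (hm : x ≤ m) (h2 : x ≤ n) (hy : y = 1 ∨ y ∈ I) (hyx : y ≤ x)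
    (hmax : ∀ z ∈ I, z ≤ x → z ≤ y) : val (idem n m I) x = y := by
  obtain ⟨a1, a2, a3⟩ := val_idem_spec (n := n) m I h1 hm h2
  apply le_antisymm
  · rcases a1 with a1 | a1
    · rw [a1]; rcases hy with h | h
      · omega
      · exact hI y h
    · exact hmax _ a1 a2
  · rcases hy with h | h
    · rw [h]; exact one_le_val _ h1 h2
    · exact a3 y h hyx

theorem dec_idem (m : ℕ) (I : Finset ℕ) : Dec (idem n m I) := dec_mk _

section idem
variable {m : ℕ} {I : Finset ℕ}

theorem val_idem_fixed (hI : I ⊆ Finset.Icc 2 m) (hm : m ≤ n) (hm1 : 1 ≤ m) {y : ℕ}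
    (hy : y = 1 ∨ y ∈ I) : val (idem n m I) y = y := by
  have h : ∀ z ∈ I, 2 ≤ z ∧ z ≤ m := fun z hz => Finset.mem_Icc.1 (hI hz)
  have hy' : 1 ≤ y ∧ y ≤ m := by
    rcases hy with h' | h'
    · omega
    · have := h y h'; omega
  exact val_idem_eq (fun z hz => by have := h z hz; omega) hy'.1 hy'.2 (by omega) hy le_rfl
    fun z _ h => h

theorem val_idem_mem (m : ℕ) (I : Finset ℕ) {x : ℕ} (h1 : 1 ≤ x) (h2 : x ≤ n) :
    val (idem n m I) x = 1 ∨ val (idem n m I) x ∈ I := by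
  rcases le_or_gt x m with h | h
  · exact (val_idem_spec m I h1 h h2).1
  · exact .inl (val_idem_of_lt m I h h2)

theorem img_idem (hI : I ⊆ Finset.Icc 2 m) (hm : m ≤ n) (hm1 : 1 ≤ m) :
    img (idem n m I) = insert 1 I := by
  ext y
  rw [mem_img, Finset.mem_insert]
  constructor
  · rintro ⟨x, h1, h2, rfl⟩
    exact val_idem_mem m I h1 h2
  · intro h
    refine ⟨y, ?_, ?_, val_idem_fixed hI hm hm1 h⟩
    · rcases h with h | h
      · omega
      · have := Finset.mem_Icc.1 (hI h); omega
    · rcases h with h | h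
      · omega
      · have := Finset.mem_Icc.1 (hI h); omega

theorem val_idem_mono (m : ℕ) (I : Finset ℕ) {x y : ℕ} (h1 : 1 ≤ x) (hxy : x ≤ y) (hy : y ≤ m)
    (h2 : y ≤ n) : val (idem n m I) x ≤ val (idem n m I) y := by
  obtain ⟨a1, a2, a3⟩ := val_idem_spec (n := n) m I h1 (by omega) (by omega)
  obtain ⟨b1, b2, b3⟩ := val_idem_spec (n := n) m I (by omega : 1 ≤ y) hy h2
  rcases a1 with a1 | a1
  · rw [a1]; exact one_le_val _ (by omega) h2
  · exact b3 _ a1 (by omega)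

theorem pForm_of_mono {α : T n} {m : ℕ}
    (hmono : ∀ x y, 1 ≤ x → x ≤ y → y ≤ m → y ≤ n → val α x ≤ val α y)
    (hone : ∀ x, 1 ≤ x → m < x → x ≤ n → val α x = 1) : PForm α := by
  intro x y z hx hxy hyz hz
  rcases le_or_gt y m with h | h
  · exact .inl (hmono x y hx hxy h (by omega))
  · exact .inr (hone z (by omega) (by omega) hz)

theorem pForm_idem (m : ℕ) (I : Finset ℕ) : PForm (idem n m I) :=
  pForm_of_mono (m := m) (fun _ _ h1 h2 h3 h4 => val_idem_mono m I h1 h2 h3 h4)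
    fun _ _ h2 h3 => val_idem_of_lt m I h2 h3

end idem

/-! ### The order-preserving degree and the idempotents in `B n r m` -/

theorem orderPreservingUpTo_iff {m : ℕ} {α : T n} : OrderPreservingUpTo m α ↔
    ∀ x y, 1 ≤ x → x ≤ y → y ≤ n → y ≤ m → val α x ≤ val α y := by
  constructor
  · intro h x y h1 h2 h3 h4
    rcases h2.eq_or_lt with h2 | h2
    · rw [h2]
    · rw [val_of_mem α h1 (by omega), val_of_mem α (by omega) h3]
      exact h ⟨x, _⟩ ⟨y, _⟩ h2 h4
  · intro h a b hab hb
    change (α a).1 ≤ (α b).1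
    rw [coe_apply, coe_apply]
    exact h _ _ a.2.1 (le_of_lt hab) b.2.2 hb

theorem opd_spec (α : T n) : opd α ≤ n ∧ OrderPreservingUpTo (opd α) α ∧
    ∀ k ≤ n, OrderPreservingUpTo k α → k ≤ opd α := by
  have hb : BddAbove {m | m ≤ n ∧ OrderPreservingUpTo m α} := ⟨n, fun m hm => hm.1⟩
  have hne : {m | m ≤ n ∧ OrderPreservingUpTo m α}.Nonempty :=
    ⟨0, n.zero_le, fun a b _ hb' => by have : 1 ≤ b.1 := b.2.1; omega⟩
  have h := Nat.sSup_mem hne hb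
  exact ⟨h.1, h.2, fun k hk hk' => le_csSup hb ⟨hk, hk'⟩⟩

theorem opd_eq {α : T n} {m : ℕ} (hm : m ≤ n) (h : OrderPreservingUpTo m α)
    (hlt : m < n → ¬ OrderPreservingUpTo (m + 1) α) : opd α = m := by
  obtain ⟨h1, h2, h3⟩ := opd_spec α
  refine le_antisymm ?_ (h3 m hm h)
  by_contra! hc
  exact hlt (by omega) fun a b hab hb => h2 a b hab (by omega)

/-- `B_m` consists of the retractions `idem n m I`. -/
theorem B_eq {r m : ℕ} (hr : 2 ≤ r) (hm1 : 1 ≤ m) (hm : m ≤ n) :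
    B n r m = idem n m '' (Finset.powersetCard (r - 1) (Finset.Icc 2 m) : Set (Finset ℕ)) := by
  ext α
  simp only [B, Set.mem_ofPred_eq, Set.mem_image, Finset.mem_coe, Finset.mem_powersetCard]
  constructor
  · rintro ⟨hα, hid, hht, hopd⟩
    rw [mem_OPDn_iff] at hα
    obtain ⟨hp, hd⟩ := hα
    have h1 := hd.val_one (by omega)
    obtain ⟨-, hmono, hlast⟩ := opd_spec α
    rw [hopd] at hmono hlast
    rw [orderPreservingUpTo_iff] at hmono
    -- Maximality of the degree `m` gives a drop whose right end is `m + 1`; `PForm` then makes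
    -- every value beyond `m` equal to `1`.
    have hone : ∀ x, m < x → x ≤ n → val α x = 1 := by
      intro x hx hxn
      have hnot : ¬ OrderPreservingUpTo (m + 1) α := fun h => by
        have := hlast (m + 1) (by omega) h; omega
      rw [orderPreservingUpTo_iff] at hnot
      push Not at hnot
      obtain ⟨a, b, a1, a2, a3, a4, a5⟩ := hnot
      have hb : b = m + 1 := by
        by_contra hb
        have := hmono a b a1 a2 a3 (by omega)
        omega
      rcases hp a b x a1 a2 (by omega) hxn with h | h
      · omega
      · exact h
    have hfix : ∀ x, 1 ≤ x → x ≤ n → val α (val α x) = val α x := by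
      intro x h1 h2
      rw [← val_mul _ _ h1 h2, hid]
    have h1img : 1 ∈ img α := mem_img.2 ⟨1, le_rfl, by omega, h1⟩
    have hI : (img α).erase 1 ⊆ Finset.Icc 2 m := by
      intro y hy
      rw [Finset.mem_erase, mem_img] at hy
      obtain ⟨hy1, x, hx1, hx2, rfl⟩ := hy
      have a1 := one_le_val α hx1 hx2
      have a2 := hd x hx1 hx2
      rw [Finset.mem_Icc]
      refine ⟨by omega, ?_⟩
      by_contra hc
      exact hy1 (hone x (by omega) hx2)
    refine ⟨(img α).erase 1, ⟨hI, ?_⟩, ?_⟩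
    · rw [Finset.card_erase_of_mem h1img, ← height_eq, hht]
    · apply ext_val
      intro x hx1 hx2
      rcases le_or_gt x m with hxm | hxm
      · refine val_idem_eq (fun z hz => ?_) hx1 hxm hx2 ?_ (hd x hx1 hx2) ?_
        · have := Finset.mem_Icc.1 (hI hz); omega
        · rw [Finset.mem_erase]
          have := val_mem_img α hx1 hx2
          tauto
        · intro z hz hzx
          rw [Finset.mem_erase, mem_img] at hz
          obtain ⟨hz1, w, hw1, hw2, rfl⟩ := hz
          rw [← hfix w hw1 hw2]
          exact hmono _ _ (one_le_val α hw1 hw2) hzx hx2 hxm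
      · rw [val_idem_of_lt m _ hxm hx2, hone x hxm hx2]
  · rintro ⟨I, ⟨hI, hc⟩, rfl⟩
    refine ⟨mem_OPDn_iff.2 ⟨pForm_idem m I, dec_idem m I⟩, ?_, ?_, ?_⟩
    · apply ext_val
      intro x h1 h2
      rw [val_mul _ _ h1 h2]
      exact val_idem_fixed hI hm hm1 (val_idem_mem m I h1 h2)
    · rw [height_eq, img_idem hI hm hm1, Finset.card_insert_of_notMem, hc]
      · omega
      · intro h
        have := Finset.mem_Icc.1 (hI h); omega
    · apply opd_eq hm
      · rw [orderPreservingUpTo_iff]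
        exact fun x y h1 h2 h3 h4 => val_idem_mono m I h1 h2 h4 h3
      · intro hlt
        rw [orderPreservingUpTo_iff]
        intro h
        have h' := h m (m + 1) hm1 (by omega) hlt le_rfl
        rw [val_idem_of_lt m I (by omega : m < m + 1) hlt] at h'
        -- Since `r ≥ 2`, the value at `m` exceeds `1`, so the degree stops at `m`.
        obtain ⟨z, hz⟩ : I.Nonempty := by
          rw [← Finset.card_pos]; omega
        have hz' := Finset.mem_Icc.1 (hI hz)
        have := (val_idem_spec (n := n) m I hm1 le_rfl hm).2.2 z hz hz'.2
        omega

/-! ### Products of retractions with a common cut -/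

/-- Retractions onto fewer than `r` points are products of those onto `r` points. -/
theorem idem_mem_closure_B {r m : ℕ} (hr : 2 ≤ r) (hrm : r < m) (hm : m ≤ n) {I : Finset ℕ}
    (hI : I ⊆ Finset.Icc 2 m) (hc : I.card ≤ r - 1) :
    idem n m I ∈ Subsemigroup.closure (B n r m) := by
  obtain ⟨k, hk⟩ : ∃ k, I.card + k = r - 1 := ⟨_, Nat.add_sub_cancel' hc⟩
  induction k generalizing I with
  | zero =>
    apply Subsemigroup.subset_closure
    rw [B_eq hr (by omega) hm]
    exact ⟨I, by simpa using ⟨hI, hk⟩, rfl⟩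
  | succ k ih =>
    have hlt : I.card < (Finset.Icc 2 m).card := by rw [Nat.card_Icc]; omega
    have hex : ∃ y, y ∈ Finset.Icc 2 m ∧ y ∉ I := by
      obtain ⟨y, hy, hy'⟩ := Finset.exists_mem_notMem_of_card_lt_card hlt
      exact ⟨y, hy, hy'⟩
    classical
    -- For the least missing `y`, the point `y - 1` lies in `I ∪ {1}`. Retract onto the larger set
    -- `insert y I`, then apply a retraction that keeps `I` and drops `y`: it moves `y` to `y - 1`,
    -- as required.
    let y := Nat.find hex
    obtain ⟨hy, hyI⟩ : y ∈ Finset.Icc 2 m ∧ y ∉ I := Nat.find_spec hex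
    have hy' := Finset.mem_Icc.1 hy
    have hpred : y - 1 = 1 ∨ y - 1 ∈ I := by
      by_contra! hcon
      exact Nat.find_min hex (show y - 1 < y by omega)
        ⟨Finset.mem_Icc.2 (by have := hcon.1; omega), hcon.2⟩
    have hsub : I ⊆ (Finset.Icc 2 m).erase y := fun z hz =>
      Finset.mem_erase.2 ⟨fun h => hyI (h ▸ hz), hI hz⟩
    -- There is room because `r < m`: without `y`, the interval `{2, …, m}` still has `m - 2 ≥ r -
    -- 1` points.
    obtain ⟨J, hIJ, hJ, hJc⟩ := Finset.exists_subsuperset_card_eq hsub hc (by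
      rw [Finset.card_erase_of_mem hy, Nat.card_Icc]; omega)
    have hJ' : J ⊆ Finset.Icc 2 m := hJ.trans (Finset.erase_subset _ _)
    have hyJ : y ∉ J := fun h => by simpa using hJ h
    have hyI' : insert y I ⊆ Finset.Icc 2 m := Finset.insert_subset hy hI
    have hcard : (insert y I).card = I.card + 1 := Finset.card_insert_of_notMem hyI
    have hfac : idem n m I = idem n m (insert y I) * idem n m J := by
      apply ext_val
      intro x h1 h2
      rw [val_mul _ _ h1 h2]
      rcases le_or_gt x m with hxm | hxm
      · obtain ⟨a1, a2, a3⟩ := val_idem_spec (n := n) m (insert y I) h1 hxm h2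
        rw [Finset.mem_insert] at a1
        have hI1 : ∀ z ∈ I, 1 ≤ z := fun z hz => by
          have := Finset.mem_Icc.1 (hI hz); omega
        by_cases hv : val (idem n m (insert y I)) x = y
        · rw [hv] at a2 a3 ⊢
          rw [val_idem_eq (y := y - 1)
            (fun z hz => by have := Finset.mem_Icc.1 (hJ' hz); omega) (by omega) hy'.2
            (by omega) (hpred.imp_right fun h => hIJ h) (by omega)]
          · refine val_idem_eq hI1 h1 hxm h2 hpred (by omega) fun z hz hzx => ?_
            have h3 := a3 z (Finset.mem_insert_of_mem hz) hzx
            have h4 : z ≠ y := fun h => hyI (h ▸ hz)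
            omega
          · intro z hz hzy
            have h4 : z ≠ y := fun h => hyJ (h ▸ hz)
            omega
        · have hmem : val (idem n m (insert y I)) x = 1 ∨ val (idem n m (insert y I)) x ∈ I := by
            tauto
          rw [val_idem_fixed hJ' hm (by omega) (hmem.imp_right fun h => hIJ h)]
          exact val_idem_eq hI1 h1 hxm h2 hmem a2
            fun z hz hzx => a3 z (Finset.mem_insert_of_mem hz) hzx
      · rw [val_idem_of_lt m _ hxm h2, val_idem_of_lt m _ hxm h2,
          val_idem_fixed hJ' hm (by omega) (.inl rfl)]
    rw [hfac]
    refine mul_mem (ih hyI' (by omega) (by omega)) (Subsemigroup.subset_closure ?_)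
    rw [B_eq hr (by omega) hm]
    exact ⟨J, by simpa using ⟨hJ', hJc⟩, rfl⟩

/-- Maps that increase on `{1, …, m}` and are `1` beyond `m` are products of retractions. -/
theorem mem_closure_B {r m : ℕ} (hr : 2 ≤ r) (hrm : r < m) (hm : m ≤ n) {α : T n} (hd : Dec α)
    (hmono : ∀ x y, 1 ≤ x → x ≤ y → y ≤ m → val α x ≤ val α y)
    (hone : ∀ x, m < x → x ≤ n → val α x = 1) (hht : (img α).card ≤ r) :
    α ∈ Subsemigroup.closure (B n r m) := by
  -- Induction on the total displacement. If every image point is fixed, `α` is already a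
  -- retraction.
  obtain ⟨N, hN⟩ : ∃ N, ∑ x ∈ Finset.Icc 1 n, (x - val α x) = N := ⟨_, rfl⟩
  induction N using Nat.strong_induction_on generalizing α with
  | _ N ih =>
  have h1 := hd.val_one (by omega)
  have h1img : 1 ∈ img α := mem_img.2 ⟨1, le_rfl, by omega, h1⟩
  have hI : (img α).erase 1 ⊆ Finset.Icc 2 m := by
    intro y hy
    rw [Finset.mem_erase, mem_img] at hy
    obtain ⟨hy1, x, hx1, hx2, rfl⟩ := hy
    have a1 := one_le_val α hx1 hx2
    have a2 := hd x hx1 hx2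
    rw [Finset.mem_Icc]
    refine ⟨by omega, ?_⟩
    by_contra hc
    exact hy1 (hone x (by omega) hx2)
  have hIc : ((img α).erase 1).card ≤ r - 1 := by
    rw [Finset.card_erase_of_mem h1img]; omega
  rcases ((img α).filter fun y => val α y ≠ y).eq_empty_or_nonempty with hemp | hne
  · have hfix : ∀ y ∈ img α, val α y = y := by
      intro y hy
      by_contra hc
      have : y ∈ (img α).filter fun y => val α y ≠ y := Finset.mem_filter.2 ⟨hy, hc⟩
      rw [hemp] at this
      simp at this
    have : α = idem n m ((img α).erase 1) := by
      apply ext_val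
      intro x hx1 hx2
      rcases le_or_gt x m with hxm | hxm
      · refine (val_idem_eq (fun z hz => ?_) hx1 hxm hx2 ?_ (hd x hx1 hx2) ?_).symm
        · have := Finset.mem_Icc.1 (hI hz); omega
        · rw [Finset.mem_erase]
          have := val_mem_img α hx1 hx2
          tauto
        · intro z hz hzx
          have hz' := Finset.mem_Icc.1 (hI hz)
          rw [← hfix z (Finset.mem_of_mem_erase hz)]
          exact hmono _ _ (by omega) hzx hxm
      · rw [val_idem_of_lt m _ hxm hx2, hone x hxm hx2]
    rw [this]
    exact idem_mem_closure_B hr hrm hm hI hIc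
  -- Take the largest image point `y` that is not fixed. Its fibre lies in `{y + 1, …}`, so raising
  -- the value `y` to `y + 1` keeps the map decreasing and lowers the displacement.
  · obtain ⟨y, hy, hymax⟩ := Finset.exists_max_image _ id hne
    simp only [Finset.mem_filter, id, and_imp] at hy hymax
    obtain ⟨hyimg, hyfix⟩ := hy
    have hfib : ∀ x, 1 ≤ x → x ≤ n → val α x = y → y + 1 ≤ x := by
      intro x hx1 hx2 hx
      have := hd x hx1 hx2
      rcases Nat.lt_or_ge y x with h | h
      · exact h
      · exact absurd (by rw [← hx]; congr 1; omega) hyfix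
    obtain ⟨w, hw1, hw2, hw⟩ := mem_img.1 hyimg
    have hyne : y ≠ 1 := fun h => hyfix (by rw [h, h1])
    have hy1 : 1 ≤ y := hw ▸ one_le_val α hw1 hw2
    have hwm : w ≤ m := by
      by_contra hc
      exact hyne (hw ▸ hone w (by omega) hw2)
    have hyw := hfib w hw1 hw2 hw
    -- Otherwise `y + 1` would be fixed by the choice of `y`, while `w ≥ y + 1` has the smaller
    -- value `y`. Hence a retraction that keeps the image of `α` and drops `y + 1` undoes the
    -- raising.
    have hsucc : y + 1 ∉ img α := by
      intro h
      have hf : val α (y + 1) = y + 1 := by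
        by_contra hc
        have := hymax _ h hc
        omega
      have := hmono (y + 1) w (by omega) hyw hwm
      omega
    let g : ℕ → ℕ := fun v => if v = y then y + 1 else v
    have hβ : ∀ x, 1 ≤ x → x ≤ n → val (mk n fun x => g (val α x)) x = g (val α x) := by
      intro x hx1 hx2
      have a1 := one_le_val α hx1 hx2
      have a2 := hd x hx1 hx2
      apply val_mk _ hx1 hx2
      · dsimp only [g]; split_ifs <;> omega
      · dsimp only [g]; split_ifs with h
        · exact hfib x hx1 hx2 h
        · exact a2
    have hsub : (img α).erase 1 ⊆ (Finset.Icc 2 m).erase (y + 1) := fun z hz =>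
      Finset.mem_erase.2 ⟨fun h => hsucc (h ▸ Finset.mem_of_mem_erase hz), hI hz⟩
    obtain ⟨J, hIJ, hJ, hJc⟩ := Finset.exists_subsuperset_card_eq hsub hIc (by
      rw [Finset.card_erase_of_mem (Finset.mem_Icc.2 (by omega)), Nat.card_Icc]; omega)
    have hJ' : J ⊆ Finset.Icc 2 m := hJ.trans (Finset.erase_subset _ _)
    have hyJ : y + 1 ∉ J := fun h => by simpa using hJ h
    have hfac : α = (mk n fun x => g (val α x)) * idem n m J := by
      apply ext_val
      intro x hx1 hx2
      rw [val_mul _ _ hx1 hx2, hβ x hx1 hx2]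
      dsimp only [g]
      split_ifs with h
      · rw [h]
        refine (val_idem_eq (fun z hz => ?_) (by omega) (by omega) (by omega) ?_ (by omega)
          fun z hz hzy => ?_).symm
        · have := Finset.mem_Icc.1 (hJ' hz); omega
        · exact .inr (hIJ (Finset.mem_erase.2 ⟨hyne, hyimg⟩))
        · have h4 : z ≠ y + 1 := fun h => hyJ (h ▸ hz)
          omega
      · refine (val_idem_fixed hJ' hm (by omega) ?_).symm
        by_cases h' : val α x = 1
        · exact .inl h'
        · exact .inr (hIJ (Finset.mem_erase.2 ⟨h', val_mem_img α hx1 hx2⟩))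
    rw [hfac]
    refine mul_mem (ih _ ?_ (dec_mk _) ?_ ?_ ?_ rfl) (Subsemigroup.subset_closure ?_)
    · rw [← hN]
      apply Finset.sum_lt_sum
      · intro x hx
        obtain ⟨hx1, hx2⟩ := Finset.mem_Icc.1 hx
        rw [hβ x hx1 hx2]
        dsimp only [g]; split_ifs <;> omega
      · refine ⟨w, Finset.mem_Icc.2 ⟨hw1, hw2⟩, ?_⟩
        rw [hβ w hw1 hw2]
        dsimp only [g]; rw [if_pos hw]; omega
    · intro x z hx hxz hz
      rw [hβ x hx (by omega), hβ z (by omega) (by omega)]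
      have := hmono x z hx hxz hz
      dsimp only [g]; split_ifs <;> omega
    · intro x hx hxn
      rw [hβ x (by omega) hxn, hone x hx hxn]
      dsimp only [g]
      rw [if_neg (by omega)]
    · have : img (mk n fun x => g (val α x)) = (img α).image g := by
        unfold img
        rw [Finset.image_image]
        exact Finset.image_congr fun x hx =>
          hβ x (Finset.mem_Icc.1 hx).1 (Finset.mem_Icc.1 hx).2
      rw [this]
      exact Finset.card_image_le.trans hht
    · rw [B_eq hr (by omega) hm]
      exact ⟨J, by simpa using ⟨hJ', hJc⟩, rfl⟩

/-! ### Generating the orientation-preserving maps from `C n r` -/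

theorem val_rho (m : ℕ) {x : ℕ} (h1 : 1 ≤ x) (h2 : x ≤ n) :
    val (rho n m) x = if x ≤ m then x else 1 := by
  rw [val_of_mem _ h1 h2]
  unfold rho
  split_ifs <;> rfl

theorem closure_B_le_closure_C {r m : ℕ} (h1 : r < m) (h2 : m ≤ n) :
    Subsemigroup.closure (B n r m) ≤ Subsemigroup.closure (C n r) :=
  Subsemigroup.closure_mono fun _ hα =>
    .inl (Set.mem_biUnion (Set.mem_Icc.2 ⟨h1, h2⟩) hα)

theorem PForm.exists_cut {α : T n} (hn : 1 ≤ n) (hp : PForm α) :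
    ∃ m, 1 ≤ m ∧ m ≤ n ∧ (∀ x y, 1 ≤ x → x ≤ y → y ≤ m → val α x ≤ val α y) ∧
      ∀ x, m < x → x ≤ n → val α x = 1 := by
  -- The cut is the last point not sent to `1`; the disjunct `x = 1` covers the constant map.
  have hne : ((Finset.Icc 1 n).filter fun x => val α x ≠ 1 ∨ x = 1).Nonempty :=
    ⟨1, by simp [hn]⟩
  obtain ⟨m, hm, hmax⟩ := Finset.exists_max_image _ id hne
  simp only [Finset.mem_filter, Finset.mem_Icc, id, and_imp] at hm hmax
  refine ⟨m, hm.1.1, hm.1.2, fun x y hx hxy hy => ?_, fun x hx hxn => ?_⟩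
  · rcases hm.2 with h | h
    · exact (hp x y m hx hxy hy hm.1.2).resolve_right h
    · rw [show x = y by omega]
  · by_contra hc
    have := hmax x (by omega) hxn (.inl hc)
    omega

/-- If the cut `m` is at most `r`, freezing `α` at its value at `m` gives an order-preserving map, a
product of elements of `B n r n`. The factor `rho n m` in front restores the values `1` beyond `m`.
-/
theorem PForm.mem_closure_C {r : ℕ} (hr : 2 ≤ r) (hrn : r < n) {α : T n} (hp : PForm α)
    (hd : Dec α) (hht : (img α).card ≤ r) : α ∈ Subsemigroup.closure (C n r) := by
  obtain ⟨m, hm1, hm, hmono, hone⟩ := hp.exists_cut (by omega)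
  rcases Nat.lt_or_ge r m with hrm | hrm
  · exact closure_B_le_closure_C hrm hm (mem_closure_B hr hrm hm hd hmono hone hht)
  have hβ : ∀ x, 1 ≤ x → x ≤ n →
      val (mk n fun x => val α (min x m)) x = val α (min x m) := by
    intro x h1 h2
    refine val_mk _ h1 h2 (one_le_val _ (by omega) (by omega)) ?_
    exact (hd _ (by omega) (by omega)).trans (by omega)
  have hmem : (mk n fun x => val α (min x m)) ∈ Subsemigroup.closure (C n r) := by
    refine closure_B_le_closure_C hrn le_rfl
      (mem_closure_B hr hrn le_rfl (dec_mk _) ?_ (fun x h1 h2 => by omega) ?_)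
    · intro x y h1 h2 h3
      rw [hβ x h1 (by omega), hβ y (by omega) h3]
      exact hmono _ _ (by omega) (by omega) (by omega)
    · refine (Finset.card_le_card fun y hy => ?_).trans hht
      obtain ⟨x, h1, h2, rfl⟩ := mem_img.1 hy
      rw [hβ x h1 h2]
      exact val_mem_img α (by omega) (by omega)
  have h1 := hd.val_one (by omega)
  -- `C n r` is not given a map `rho n 1`, but for `m = 1` freezing does not change `α`.
  rcases hm1.eq_or_lt with hm1' | hm1'
  · have : α = mk n fun x => val α (min x m) := by
      apply ext_val
      intro x hx1 hx2
      rw [hβ x hx1 hx2]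
      rcases le_or_gt x m with h | h
      · rw [min_eq_left h]
      · rw [hone x h hx2, min_eq_right h.le, ← hm1', h1]
    rw [this]; exact hmem
  · have : α = rho n m * mk n fun x => val α (min x m) := by
      apply ext_val
      intro x hx1 hx2
      rw [val_mul _ _ hx1 hx2, val_rho m hx1 hx2]
      split_ifs with h
      · rw [hβ x hx1 hx2, min_eq_left h]
      · rw [hβ 1 le_rfl (by omega), min_eq_left hm1, h1, hone x (by omega) hx2]
    rw [this]
    exact mul_mem (Subsemigroup.subset_closure (.inr ⟨m, Set.mem_Icc.2 ⟨hm1', hrm⟩, rfl⟩)) hmem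

/-! ### The maps `lam` and the factorization of reversing maps -/

theorem val_lam (r m : ℕ) {x : ℕ} (h1 : 1 ≤ x) (h2 : x ≤ n) :
    val (lam n r m) x = if m ≤ x ∧ x < 2 * m ∧ (m + r ≤ n + 1 → x + (m - r) + 2 ≤ 2 * m)
      then 2 * m - x else 1 := by
  rw [val_of_mem _ h1 h2]
  unfold lam
  split_ifs <;> first | rfl | (exfalso; simp only at *; omega)

theorem dec_lam (r m : ℕ) : Dec (lam n r m) := by
  intro x h1 h2
  rw [val_lam r m h1 h2]
  split_ifs <;> omega

theorem qForm_lam (r m : ℕ) : QForm (lam n r m) := by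
  intro x y z hx hxy hyz hz
  rw [val_lam r m hx (by omega), val_lam r m (by omega) hz,
    val_lam r m (by omega) (by omega : y ≤ n)]
  split_ifs <;> omega

/-- Apart from `1`, the image has at most `r - 1` points: either the cut-off `p` ensures this, or
`{m, …, n}` is itself that short. -/
theorem card_img_lam_le {r m : ℕ} (hr : 1 ≤ r) (hm : 2 ≤ m) (hmn : m ≤ n) :
    (img (lam n r m)).card ≤ r := by
  by_cases hc : m + r ≤ n + 1
  · have hsub : img (lam n r m) ⊆ insert 1 (Finset.Icc (m - r + 2) m) := by
      intro y hy
      obtain ⟨x, h1, h2, rfl⟩ := mem_img.1 hy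
      rw [val_lam r m h1 h2, Finset.mem_insert, Finset.mem_Icc]
      split_ifs <;> omega
    have h1 := Finset.card_le_card hsub
    have h2 := Finset.card_insert_le 1 (Finset.Icc (m - r + 2) m)
    rw [Nat.card_Icc] at h2
    omega
  · have hsub : img (lam n r m) ⊆ insert 1 (Finset.Icc (2 * m - n) m) := by
      intro y hy
      obtain ⟨x, h1, h2, rfl⟩ := mem_img.1 hy
      rw [val_lam r m h1 h2, Finset.mem_insert, Finset.mem_Icc]
      split_ifs <;> omega
    have h1 := Finset.card_le_card hsub
    have h2 := Finset.card_insert_le 1 (Finset.Icc (2 * m - n) m)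
    rw [Nat.card_Icc] at h2
    omega

/-- Here `m` is the first point not sent to `1`. The failure of `PForm` supplies a point beyond it,
so `m < n`. -/
theorem QForm.exists_start {α : T n} (hq : QForm α) (hnp : ¬ PForm α) (hd : Dec α) :
    ∃ m, 2 ≤ m ∧ m < n ∧ val α m ≠ 1 ∧ (∀ x, 1 ≤ x → x < m → val α x = 1) ∧
      ∀ x y, m ≤ x → x ≤ y → y ≤ n → val α y ≤ val α x := by
  unfold PForm at hnp
  push Not at hnp
  obtain ⟨x, y, z, h1, h2, h3, h4, h5, h6⟩ := hnp
  have hy := one_le_val α (by omega : 1 ≤ y) (by omega)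
  have hex : ∃ m, 1 ≤ m ∧ m ≤ n ∧ val α m ≠ 1 := ⟨x, h1, by omega, by omega⟩
  classical
  obtain ⟨g1, g2, g3⟩ := Nat.find_spec hex
  have gmin := fun m (h : m < Nat.find hex) => Nat.find_min hex h
  have hmx : Nat.find hex ≤ x := Nat.find_le ⟨h1, by omega, by omega⟩
  generalize Nat.find hex = m at *
  have hone := hd.val_one (by omega)
  have hxy : x ≠ y := fun h => by rw [h] at h5; omega
  refine ⟨m, ?_, ?_, g3, ?_, ?_⟩
  · have : m ≠ 1 := fun h => g3 (h ▸ hone)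
    omega
  · omega
  · intro x hx1 hx2
    by_contra hc
    exact gmin x hx2 ⟨hx1, by omega, hc⟩
  · intro x y hx hxy hy
    exact (hq m x y g1 hx hxy hy).resolve_left g3

/-- An orientation-reversing map that is not orientation-preserving is a product `ε * λ_m * γ` with `ε`, `γ` in `OPD_n`. -/
theorem QForm.mem_closure {r : ℕ} (hr : 3 ≤ r) (hrn : r < n) {α : T n} (hq : QForm α)
    (hnp : ¬ PForm α) (hd : Dec α) (hht : (img α).card ≤ r) :
    α ∈ Subsemigroup.closure (C n r ∪ G n r) := by
  obtain ⟨m, hm2, hmn, hm, hone, hanti⟩ := hq.exists_start hnp hd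
  have hone1 := hd.val_one (by omega)
  have hαm := hd m (by omega) (by omega)
  have hle : ∀ x, 1 ≤ x → x ≤ n → val α x ≤ m := by
    intro x h1 h2
    rcases Nat.lt_or_ge x m with h | h
    · rw [hone x h1 h]; omega
    · exact (hanti m x le_rfl h h2).trans hαm
  -- `c v` is the number of image points above `v`.
  let c : ℕ → ℕ := fun v => ((img α).filter (v < ·)).card
  have c_lt : ∀ v w, w ∈ img α → v < w → c w < c v := by
    intro v w hw hvw
    apply Finset.card_lt_card
    rw [Finset.ssubset_iff_of_subset]
    · exact ⟨w, Finset.mem_filter.2 ⟨hw, hvw⟩, by simp⟩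
    · intro u hu
      rw [Finset.mem_filter] at hu ⊢
      exact ⟨hu.1, by omega⟩
  have c_le : ∀ v w, v ≤ w → c w ≤ c v := by
    intro v w hvw
    apply Finset.card_le_card
    intro u hu
    rw [Finset.mem_filter] at hu ⊢
    exact ⟨hu.1, by omega⟩
  have c_val : ∀ v, v ≤ m → v + c v ≤ m := by
    intro v hv
    have : (img α).filter (v < ·) ⊆ Finset.Ioc v m := by
      intro u hu
      rw [Finset.mem_filter] at hu
      obtain ⟨x, h1, h2, rfl⟩ := mem_img.1 hu.1
      exact Finset.mem_Ioc.2 ⟨hu.2, hle x h1 h2⟩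
    have := Finset.card_le_card this
    rw [Nat.card_Ioc] at this
    change v + ((img α).filter (v < ·)).card ≤ m
    omega
  -- All image points above the value at `x` are attained on `{m, …, x - 1}`.
  have c_pos : ∀ x, m ≤ x → x ≤ n → m + c (val α x) ≤ x := by
    intro x hmx hxn
    have : (img α).filter (val α x < ·) ⊆ (Finset.Ico m x).image (val α) := by
      intro u hu
      rw [Finset.mem_filter] at hu
      obtain ⟨w, h1, h2, rfl⟩ := mem_img.1 hu.1
      refine Finset.mem_image.2 ⟨w, Finset.mem_Ico.2 ⟨?_, ?_⟩, rfl⟩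
      · by_contra hc
        have := hone w h1 (by omega)
        have := one_le_val α (by omega : 1 ≤ x) hxn
        omega
      · by_contra hc
        have := hanti x w hmx (by omega) h2
        omega
    have := (Finset.card_le_card this).trans Finset.card_image_le
    rw [Nat.card_Ico] at this
    change m + ((img α).filter (val α x < ·)).card ≤ x
    omega
  have h1img : 1 ∈ img α := mem_img.2 ⟨1, le_rfl, by omega, hone1⟩
  have c_card : ∀ x, 1 ≤ x → x ≤ n → val α x ≠ 1 → c (val α x) + 2 ≤ (img α).card := by
    intro x h1 h2 h3
    have h4 := one_le_val α h1 h2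
    have h5 := c_lt 1 _ (val_mem_img α h1 h2) (by omega)
    have h6 : (img α).filter (1 < ·) ⊆ (img α).erase 1 := by
      intro u hu
      rw [Finset.mem_filter] at hu
      exact Finset.mem_erase.2 ⟨by omega, hu.1⟩
    have h7 := Finset.card_le_card h6
    rw [Finset.card_erase_of_mem h1img] at h7
    change c 1 ≤ _ at h7
    omega
  have card_le_m : (img α).card ≤ m := by
    have : img α ⊆ Finset.Icc 1 m := by
      intro u hu
      obtain ⟨x, h1, h2, rfl⟩ := mem_img.1 hu
      exact Finset.mem_Icc.2 ⟨one_le_val α h1 h2, hle x h1 h2⟩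
    simpa using Finset.card_le_card this
  have card_le_n : (img α).card ≤ n - m + 2 := by
    have : img α ⊆ insert 1 ((Finset.Icc m n).image (val α)) := by
      intro u hu
      obtain ⟨x, h1, h2, rfl⟩ := mem_img.1 hu
      rcases Nat.lt_or_ge x m with h | h
      · rw [hone x h1 h]; exact Finset.mem_insert_self _ _
      · exact Finset.mem_insert_of_mem (Finset.mem_image_of_mem _ (Finset.mem_Icc.2 ⟨h, h2⟩))
    have h1 := Finset.card_le_card this
    have h2 := Finset.card_insert_le 1 ((Finset.Icc m n).image (val α))
    have h3 : ((Finset.Icc m n).image (val α)).card ≤ _ := Finset.card_image_le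
    rw [Nat.card_Icc] at h3
    omega
  -- The bounds `m` and `n - m + 2` add up to `n + 2`, so the height is at most `(n + 2) / 2`. Hence
  -- `r̂` can replace `r`.
  have hhat : (img α).card ≤ rhat n r := by unfold rhat; omega
  -- For `m = 2` only the values `1` and `2` occur, and such a map is also orientation-preserving.
  have hm3 : 3 ≤ m := by
    by_contra hc
    obtain rfl : m = 2 := by omega
    refine hnp fun x y z hx hxy hyz hz => ?_
    by_contra! hcon
    have h1 := one_le_val α hx (by omega)
    have h2 := hle z (by omega) hz
    have h3 := one_le_val α (by omega : 1 ≤ z) hz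
    have h4 := one_le_val α (by omega : 1 ≤ y) (by omega)
    have h5 := hle x hx (by omega)
    have h6 := hanti y z (by
      by_contra hc'
      rw [show x = y by omega] at hcon
      omega) hyz hz
    omega
  -- The fibre over `v ≠ 1` goes to `m + c v`, which `lam` reflects to `m - c v`; the last factor
  -- has to take this to `v`.
  let f : ℕ → ℕ := fun x => if val α x = 1 then 1 else m + c (val α x)
  have hf1 : ∀ x, 1 ≤ x → x ≤ n → val α x ≠ 1 → m ≤ x := by
    intro x h1 h2 h3
    by_contra hc
    exact h3 (hone x h1 (by omega))
  have hε : ∀ x, 1 ≤ x → x ≤ n → val (mk n f) x = f x := by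
    intro x h1 h2
    apply val_mk f h1 h2
    · dsimp only [f]; split_ifs <;> omega
    · dsimp only [f]; split_ifs with h
      · exact h1
      · exact c_pos x (hf1 x h1 h2 h) h2
  -- `S y` holds `1` and the image points `v` with `m - c v ≤ y`. As `m - c v` is strictly
  -- increasing on the image, the largest element of `S (m - c v)` is `v`; `c_val` makes the
  -- resulting map decreasing.
  let S : ℕ → Finset ℕ := fun y => (img α).filter fun v => v = 1 ∨ m ≤ y + c v
  have hS1 : ∀ y, 1 ∈ S y := fun y => Finset.mem_filter.2 ⟨h1img, .inl rfl⟩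
  let g : ℕ → ℕ := fun y => (S y).sup id
  have hgmem : ∀ y, g y ∈ S y := by
    intro y
    obtain ⟨v, hv, hv'⟩ := Finset.exists_mem_eq_sup _ ⟨1, hS1 y⟩ id
    change (S y).sup id ∈ S y
    rw [hv']; exact hv
  have hgle : ∀ y v, v ∈ S y → v ≤ g y := fun y v hv => Finset.le_sup (f := id) hv
  have hγ : ∀ y, 1 ≤ y → y ≤ n → val (mk n g) y = g y := by
    intro y h1 h2
    apply val_mk g h1 h2 (hgle y 1 (hS1 y))
    obtain ⟨a1, a2⟩ := Finset.mem_filter.1 (hgmem y)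
    rcases a2 with a2 | a2
    · omega
    · obtain ⟨x, hx1, hx2, hx⟩ := mem_img.1 a1
      have := c_val (g y) (hx ▸ hle x hx1 hx2)
      omega
  have hfac : α = mk n f * lam n (rhat n r) m * mk n g := by
    apply ext_val
    intro x h1 h2
    have hfx := one_le_val (mk n f) h1 h2
    have hfx' := val_le_top (mk n f) h1 h2
    have hlx := one_le_val (lam n (rhat n r) m) hfx hfx'
    have hlx' := val_le_top (lam n (rhat n r) m) hfx hfx'
    rw [val_mul _ _ h1 h2, val_mul _ _ h1 h2, hγ _ hlx hlx', val_lam _ _ hfx hfx',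
      hε x h1 h2]
    rw [hε x h1 h2] at hfx hfx'
    by_cases hx : val α x = 1
    · have : f x = 1 := if_pos hx
      rw [this, if_neg (by omega), hx]
      obtain ⟨a1, a2⟩ := Finset.mem_filter.1 (hgmem 1)
      rcases a2 with a2 | a2
      · exact a2.symm
      · obtain ⟨w, hw1, hw2, hw⟩ := mem_img.1 a1
        have a3 := c_val (g 1) (hw ▸ hle w hw1 hw2)
        have a4 := hgle 1 1 (hS1 1)
        omega
    · have hfx2 : f x = m + c (val α x) := if_neg hx
      have hcc := c_card x h1 h2 hx
      rw [hfx2] at hfx' ⊢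
      -- The bound `c v + 2 ≤ |img α|`, with `|img α|` at most `m` and `r̂`, puts `m + c v` in the
      -- reflected block.
      rw [if_pos (by omega)]
      apply le_antisymm
      · apply hgle
        exact Finset.mem_filter.2 ⟨val_mem_img α h1 h2, .inr (by omega)⟩
      · obtain ⟨a1, a2⟩ := Finset.mem_filter.1 (hgmem (2 * m - (m + c (val α x))))
        rcases a2 with a2 | a2
        · rw [a2]; exact one_le_val α h1 h2
        · by_contra! hcon
          have := c_lt _ _ a1 hcon
          omega
  have hε_mem : mk n f ∈ Subsemigroup.closure (C n r) := by
    refine PForm.mem_closure_C (by omega) hrn ?_ (dec_mk f) ?_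
    · intro x y z hx hxy hyz hz
      rw [hε x hx (by omega), hε y (by omega) (by omega), hε z (by omega) hz]
      by_cases hzz : val α z = 1
      · right; exact if_pos hzz
      · left
        dsimp only [f]
        split_ifs with p1 p2
        · exact le_rfl
        · omega
        · have q1 := hf1 x hx (by omega) p1
          have := hanti y z (by omega) hyz hz
          have := one_le_val α (by omega : 1 ≤ z) hz
          omega
        · have q1 := hf1 x hx (by omega) p1
          have := c_le _ _ (hanti x y q1 hxy (by omega))
          omega
    · have : img (mk n f) = (img α).image fun v => if v = 1 then 1 else m + c v := by
        unfold img
        rw [Finset.image_image]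
        exact Finset.image_congr fun x hx =>
          hε x (Finset.mem_Icc.1 hx).1 (Finset.mem_Icc.1 hx).2
      rw [this]
      exact Finset.card_image_le.trans hht
  have hγ_mem : mk n g ∈ Subsemigroup.closure (C n r) := by
    refine PForm.mem_closure_C (by omega) hrn ?_ (dec_mk g) ?_
    · intro x y z hx hxy hyz hz
      left
      rw [hγ x hx (by omega), hγ y (by omega) (by omega)]
      apply hgle
      obtain ⟨a1, a2⟩ := Finset.mem_filter.1 (hgmem x)
      exact Finset.mem_filter.2 ⟨a1, a2.imp_right fun h => by omega⟩
    · refine (Finset.card_le_card fun y hy => ?_).trans hht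
      obtain ⟨x, h1, h2, rfl⟩ := mem_img.1 hy
      rw [hγ x h1 h2]
      exact (Finset.mem_filter.1 (hgmem x)).1
  have hmono : Subsemigroup.closure (C n r) ≤ Subsemigroup.closure (C n r ∪ G n r) :=
    Subsemigroup.closure_mono Set.subset_union_left
  rw [hfac]
  exact mul_mem (mul_mem (hmono hε_mem) (Subsemigroup.subset_closure
    (.inr ⟨m, Set.mem_Icc.2 ⟨hm3, by omega⟩, rfl⟩))) (hmono hγ_mem)

/-! ### The generating set of `ORD n r` -/

theorem dec_rho (m : ℕ) : Dec (rho n m) := by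
  intro x h1 h2
  rw [val_rho m h1 h2]
  split_ifs <;> omega

theorem pForm_rho (m : ℕ) : PForm (rho n m) := by
  intro x y z hx hxy hyz hz
  rw [val_rho m hx (by omega), val_rho m (by omega) hz,
    val_rho m (by omega) (by omega : y ≤ n)]
  split_ifs <;> omega

theorem card_img_rho_le {m : ℕ} (hm : 1 ≤ m) : (img (rho n m)).card ≤ m := by
  have : img (rho n m) ⊆ Finset.Icc 1 m := by
    intro u hu
    obtain ⟨x, h1, h2, rfl⟩ := mem_img.1 hu
    rw [val_rho m h1 h2, Finset.mem_Icc]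
    split_ifs <;> omega
  simpa using Finset.card_le_card this

theorem pForm_of_mem_C {r : ℕ} {α : T n} (h : α ∈ C n r) : PForm α := by
  rcases h with h | ⟨m, hm, rfl⟩
  · simp only [Set.mem_iUnion] at h
    obtain ⟨m, _, h⟩ := h
    exact (mem_OPDn_iff.1 h.1).1
  · exact pForm_rho m

theorem C_subset_ORD (r : ℕ) : C n r ⊆ ORD n r := by
  rintro α (h | ⟨m, hm, rfl⟩)
  · simp only [Set.mem_iUnion] at h
    obtain ⟨m, _, h⟩ := h
    obtain ⟨h1, h2⟩ := mem_OPDn_iff.1 h.1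
    exact mem_ORD_iff.2 ⟨.inl h1, h2, by rw [← height_eq, h.2.2.1]⟩
  · rw [Set.mem_Icc] at hm
    exact mem_ORD_iff.2 ⟨.inl (pForm_rho m), dec_rho m, (card_img_rho_le (by omega)).trans hm.2⟩

theorem lam_mem_ORD {r m : ℕ} (hr : 1 ≤ r) (hm : 2 ≤ m) (hmn : m ≤ n) :
    lam n (rhat n r) m ∈ ORD n r :=
  mem_ORD_iff.2 ⟨.inr (qForm_lam _ m), dec_lam _ m,
    (card_img_lam_le (by unfold rhat; omega) hm hmn).trans (min_le_left _ _)⟩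

theorem isGeneratingSet {r : ℕ} (hr : 3 ≤ r) (hrn : r < n) :
    IsGeneratingSet (C n r ∪ G n r) (ORD n r) := by
  refine ⟨⟨rho n 2, .inl (.inr ⟨2, Set.mem_Icc.2 (by omega), rfl⟩)⟩, ?_⟩
  apply Set.Subset.antisymm
  · have : Subsemigroup.closure (C n r ∪ G n r) ≤ ordSubsemigroup n r := by
      rw [Subsemigroup.closure_le]
      rintro α (h | ⟨m, hm, rfl⟩)
      · exact C_subset_ORD r h
      · rw [Set.mem_Icc] at hm
        exact lam_mem_ORD (by omega) (by omega) (by omega)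
    exact this
  · intro α hα
    obtain ⟨h1, h2, h3⟩ := mem_ORD_iff.1 hα
    by_cases hp : PForm α
    · exact Subsemigroup.closure_mono Set.subset_union_left
        (hp.mem_closure_C (by omega) hrn h2 h3)
    · exact (h1.resolve_left hp).mem_closure hr hrn hp h2 h3

/-! ### Unavoidable generators -/

instance : Finite (T n) := inferInstanceAs (Finite (X n → X n))

/-- A generating set meets every set whose complement is closed under products. -/
theorem IsGeneratingSet.exists_mem {A S D : Set (T n)} (hA : IsGeneratingSet A S) {g : T n}
    (hg : g ∈ S) (hgD : g ∈ D)
    (hD : ∀ a ∈ S, ∀ b ∈ S, a * b ∈ D → a ∈ D ∨ b ∈ D) : ∃ a ∈ A, a ∈ D := by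
  by_contra! hcon
  have key : ∀ x ∈ Subsemigroup.closure A, x ∉ D := by
    intro x hx
    induction hx using Subsemigroup.closure_induction with
    | mem x hx => exact hcon x hx
    | mul x y hx hy ihx ihy =>
      intro h
      rcases hD x (hA.2 ▸ hx) y (hA.2 ▸ hy) h with h | h
      · exact ihx h
      · exact ihy h
  rw [← hA.2] at hg
  exact key g hg hgD

theorem IsGeneratingSet.mem_of_prime {A S : Set (T n)} (hA : IsGeneratingSet A S) {g : T n}
    (hg : g ∈ S) (h : ∀ a ∈ S, ∀ b ∈ S, a * b = g → a = g ∨ b = g) : g ∈ A := by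
  obtain ⟨a, ha, rfl⟩ := hA.exists_mem (D := {g}) hg rfl h
  exact ha

theorem val_eq_of_fixed {a b : T n} (da : Dec a) (db : Dec b) {i : ℕ} (h1 : 1 ≤ i)
    (h2 : i ≤ n) (h : val (a * b) i = i) : val a i = i ∧ val b i = i := by
  rw [val_mul _ _ h1 h2] at h
  have h3 := da i h1 h2
  have h4 := db (val a i) (one_le_val a h1 h2) (val_le_top a h1 h2)
  have h5 : val a i = i := by omega
  exact ⟨h5, by rwa [h5] at h⟩

/-- Both factors fix the image of `e` pointwise. By the size bound `a` has the same image as `e`,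
and `b` acts on it as the identity. -/
theorem left_eq_of_mul_idempotent {a b e : T n} (da : Dec a) (db : Dec b) (he : e * e = e)
    (hc : (img a).card ≤ (img e).card) (hab : a * b = e) : a = e := by
  have hfix : ∀ i ∈ img e, val a i = i ∧ val b i = i := by
    intro i hi
    obtain ⟨x, h1, h2, rfl⟩ := mem_img.1 hi
    apply val_eq_of_fixed da db (one_le_val e h1 h2) (val_le_top e h1 h2)
    rw [hab, ← val_mul _ _ h1 h2, he]
  have hsub : img e ⊆ img a := by
    intro i hi
    obtain ⟨x, h1, h2, rfl⟩ := mem_img.1 hi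
    exact mem_img.2 ⟨_, one_le_val e h1 h2, val_le_top e h1 h2, (hfix _ hi).1⟩
  have heq := Finset.eq_of_subset_of_card_le hsub hc
  apply ext_val
  intro x h1 h2
  have hx : val a x ∈ img e := heq ▸ val_mem_img a h1 h2
  rw [← hab, val_mul _ _ h1 h2, (hfix _ hx).2]

/-- Both factors fix `1, …, m`. If `a` does not send all later points to `1`, it must fix `m + 1`;
then `b` sends `m + 1` to `1`, and by its form all later points too. -/
theorem eq_or_eq_of_mul_eq_rho {m : ℕ} (hm : 2 ≤ m) (hmn : m < n) {a b : T n}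
    (ha : a ∈ ORDn n) (hb : b ∈ ORDn n) (hab : a * b = rho n m) : a = rho n m ∨ b = rho n m := by
  obtain ⟨pa, da⟩ := mem_ORDn_iff.1 ha
  obtain ⟨pb, db⟩ := mem_ORDn_iff.1 hb
  have hfix : ∀ i, 1 ≤ i → i ≤ m → val a i = i ∧ val b i = i := by
    intro i h1 h2
    apply val_eq_of_fixed da db h1 (by omega)
    rw [hab, val_rho m h1 (by omega), if_pos h2]
  have hout : ∀ x, m < x → x ≤ n → val b (val a x) = 1 := by
    intro x h1 h2
    rw [← val_mul _ _ (by omega) h2, hab, val_rho m (by omega) h2, if_neg (by omega)]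
  by_cases hc : ∀ x, m < x → x ≤ n → val a x = 1
  · left
    apply ext_val
    intro x h1 h2
    rw [val_rho m h1 h2]
    split_ifs with h
    · exact (hfix x h1 h).1
    · exact hc x (by omega) h2
  · right
    push Not at hc
    obtain ⟨x, hx1, hx2, hx⟩ := hc
    -- A value in `{2, …, m}` would be fixed by `b` instead of being sent to `1`.
    have hbig : ∀ z, m < z → z ≤ n → val a z ≠ 1 → m < val a z := by
      intro z h1 h2 h3
      by_contra hle
      have := (hfix (val a z) (one_le_val a (by omega) h2) (by omega)).2
      rw [hout z h1 h2] at this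
      exact h3 this.symm
    have ham := (hfix m (by omega) le_rfl).1
    have hbm := (hfix m (by omega) le_rfl).2
    have hpa : val a m ≤ val a (m + 1) := by
      rcases pa with p | q
      · exact (p m (m + 1) x (by omega) (by omega) hx1 hx2).resolve_right hx
      · have h1 := (q m m x (by omega) le_rfl hx1.le hx2).resolve_left (by omega)
        have h2 := hbig x hx1 hx2 hx
        omega
    have h3 := da (m + 1) (by omega) (by omega)
    have h4 := hbig (m + 1) (by omega) (by omega) (by omega)
    have hb1 : val b (m + 1) = 1 := by
      have := hout (m + 1) (by omega) (by omega)
      rwa [show val a (m + 1) = m + 1 by omega] at this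
    apply ext_val
    intro z h1 h2
    rw [val_rho m h1 h2]
    split_ifs with h
    · exact (hfix z h1 h).2
    · rcases pb with p | q
      · exact (p m (m + 1) z (by omega) (by omega) (by omega) h2).resolve_left (by omega)
      · have h5 := (q m (m + 1) z (by omega) (by omega) (by omega) h2).resolve_left (by omega)
        have h6 := one_le_val b h1 h2
        omega

theorem C_subset_of_isGeneratingSet {r : ℕ} (hrn : r < n) {A : Set (T n)}
    (hA : IsGeneratingSet A (ORD n r)) : C n r ⊆ A := by
  intro g hg
  refine hA.mem_of_prime (C_subset_ORD r hg) fun a ha b hb hab => ?_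
  rcases hg with h | ⟨m, hm, rfl⟩
  · simp only [Set.mem_iUnion] at h
    obtain ⟨m, _, h⟩ := h
    obtain ⟨-, da, hta⟩ := mem_ORD_iff.1 ha
    obtain ⟨-, db, -⟩ := mem_ORD_iff.1 hb
    exact .inl (left_eq_of_mul_idempotent da db h.2.1 (by rwa [← height_eq g, h.2.2.1]) hab)
  · rw [Set.mem_Icc] at hm
    exact eq_or_eq_of_mul_eq_rho hm.1 (by omega) ha.1 hb.1 hab

/-- Maps that start a reflection at `m`. -/
def Refl (n m : ℕ) : Set (T n) := {α ∈ ORDn n | val α m = m ∧ val α (m + 1) = m - 1}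

section Refl
variable {m : ℕ}

/-- For `m ≥ 3` the drop at `m + 1` ends at `m - 1 ≠ 1`. -/
theorem not_pForm_of_mem_Refl (hm : 3 ≤ m) (hmn : m < n) {α : T n} (h : α ∈ Refl n m) :
    ¬ PForm α := by
  intro hp
  obtain ⟨-, h1, h2⟩ := h
  have := hp m (m + 1) (m + 1) (by omega) (by omega) le_rfl (by omega)
  omega

theorem Refl_disjoint {m' : ℕ} (hm : 3 ≤ m) (hmm : m < m') (hmn : m' < n) {α : T n}
    (h : α ∈ Refl n m) (h' : α ∈ Refl n m') : False := by
  have hq := (mem_ORDn_iff.1 h.1).1.resolve_left (not_pForm_of_mem_Refl hm (by omega) h)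
  have h1 := h.2.1
  have h2 := h'.2.1
  have := hq m m m' (by omega) le_rfl (by omega) (by omega)
  omega

/-- One factor is preserving and the other reversing, and both fix `m`. If `a` is preserving, it
must fix `m + 1`, so `b` reflects there; if `a` is reversing, it must itself send `m + 1` to `m -
1`. -/
theorem mem_Refl_or_mem_Refl (hm : 3 ≤ m) (hmn : m < n) {a b : T n} (ha : a ∈ ORDn n)
    (hb : b ∈ ORDn n) (hab : a * b ∈ Refl n m) : a ∈ Refl n m ∨ b ∈ Refl n m := by
  obtain ⟨pa, da⟩ := mem_ORDn_iff.1 ha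
  obtain ⟨pb, db⟩ := mem_ORDn_iff.1 hb
  have hnp := not_pForm_of_mem_Refl hm hmn hab
  obtain ⟨h1, h2⟩ := val_eq_of_fixed da db (by omega) hmn.le hab.2.1
  have h3 := hab.2.2
  rw [val_mul _ _ (by omega) (by omega)] at h3
  have h4 := da (m + 1) (by omega) (by omega)
  have h5 := db (val a (m + 1)) (one_le_val a (by omega) (by omega))
    (val_le_top a (by omega) (by omega))
  have h6 : val a (m + 1) ≠ m := fun h => by rw [h, h2] at h3; omega
  rcases pa with p | p <;> rcases pb with q | q
  · exact absurd (p.mul_p q db) hnp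
  · right
    have h7 : val a (m + 1) = m + 1 := by
      rcases p m (m + 1) (m + 1) (by omega) (by omega) le_rfl (by omega) with h | h
      · omega
      · omega
    rw [h7] at h3
    exact ⟨hb, h2, h3⟩
  · left
    have h7 := (p m m (m + 1) (by omega) le_rfl (by omega) (by omega)).resolve_left (by omega)
    exact ⟨ha, h1, by omega⟩
  · exact absurd (p.mul_q q db) hnp

theorem lam_mem_Refl {r : ℕ} (hr : 3 ≤ r) (hrn : r < n) (hm : 3 ≤ m) (hmn : m < n) :
    lam n (rhat n r) m ∈ Refl n m := by
  have hhat : 3 ≤ rhat n r := by unfold rhat; omega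
  refine ⟨(lam_mem_ORD (r := r) (by omega) (by omega) hmn.le).1, ?_, ?_⟩
  · rw [val_lam _ _ (by omega) hmn.le, if_pos (by omega)]; omega
  · rw [val_lam _ _ (by omega) (by omega), if_pos (by omega)]; omega

end Refl

/-- Stated for any choice of representatives, so that it counts both the maps `lam` and the elements
picked from an arbitrary generating set. -/
theorem ncard_C_union {r : ℕ} {f : ℕ → T n} (hf : ∀ m, 3 ≤ m → m < n → f m ∈ Refl n m) :
    (C n r ∪ f '' Set.Icc 3 (n - 1)).ncard = (C n r).ncard + (n - 3) := by
  rw [Set.ncard_union_eq]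
  · rw [Set.InjOn.ncard_image]
    · rw [← Finset.coe_Icc, Set.ncard_coe_finset, Nat.card_Icc]; omega
    · intro m hm m' hm' heq
      rw [Set.mem_Icc] at hm hm'
      have h := hf m hm.1 (by omega)
      have h' := hf m' hm'.1 (by omega)
      rcases lt_trichotomy m m' with hlt | hlt | hlt
      · exact (Refl_disjoint hm.1 hlt (by omega) h (heq ▸ h')).elim
      · exact hlt
      · exact (Refl_disjoint hm'.1 hlt (by omega) (heq ▸ h') h).elim
  · rw [Set.disjoint_left]
    rintro α hα ⟨m, hm, rfl⟩
    rw [Set.mem_Icc] at hm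
    exact not_pForm_of_mem_Refl hm.1 (by omega) (hf m hm.1 (by omega)) (pForm_of_mem_C hα)

theorem ncard_C_union_G {r : ℕ} (hr : 3 ≤ r) (hrn : r < n) :
    (C n r ∪ G n r).ncard = (C n r).ncard + (n - 3) := by
  have : G n r = (fun m => lam n (rhat n r) m) '' Set.Icc 3 (n - 1) := by
    ext α
    constructor
    · rintro ⟨m, hm, rfl⟩; exact ⟨m, hm, rfl⟩
    · rintro ⟨m, hm, rfl⟩; exact ⟨m, hm, rfl⟩
  rw [this]
  exact ncard_C_union fun m h1 h2 => lam_mem_Refl hr hrn h1 h2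

theorem le_ncard_of_isGeneratingSet {r : ℕ} (hr : 3 ≤ r) (hrn : r < n) {A : Set (T n)}
    (hA : IsGeneratingSet A (ORD n r)) : (C n r).ncard + (n - 3) ≤ A.ncard := by
  have hex : ∀ m, ∃ a, 3 ≤ m → m < n → a ∈ A ∧ a ∈ Refl n m := by
    intro m
    by_cases h : 3 ≤ m ∧ m < n
    · obtain ⟨a, ha, ha'⟩ := hA.exists_mem (D := Refl n m)
        (lam_mem_ORD (r := r) (by omega) (by omega) h.2.le) (lam_mem_Refl hr hrn h.1 h.2)
        fun a ha b hb hab => mem_Refl_or_mem_Refl h.1 h.2 ha.1 hb.1 hab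
      exact ⟨a, fun _ _ => ⟨ha, ha'⟩⟩
    · exact ⟨rho n 1, fun h1 h2 => absurd ⟨h1, h2⟩ h⟩
  choose f hf using hex
  rw [← ncard_C_union (r := r) fun m h1 h2 => (hf m h1 h2).2]
  apply Set.ncard_le_ncard _ (Set.toFinite A)
  rintro α (h | ⟨m, hm, rfl⟩)
  · exact C_subset_of_isGeneratingSet hrn hA h
  · rw [Set.mem_Icc] at hm
    exact (hf m hm.1 (by omega)).1

/-! ### Counting and the rank of `ORD n r` -/

/-- The hockey-stick identity; the summand `1` is its missing term `m = r`. -/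
theorem sum_choose_add_one {r : ℕ} (hr : 1 ≤ r) (hrn : r ≤ n) :
    ∑ m ∈ Finset.Icc (r + 1) n, (m - 1).choose (r - 1) + 1 = n.choose r := by
  induction n, hrn using Nat.le_induction with
  | base => simp
  | succ k hk ih =>
    obtain ⟨s, rfl⟩ : ∃ s, r = s + 1 := ⟨r - 1, by omega⟩
    rw [Finset.sum_Icc_succ_top (by omega), Nat.choose_succ_succ, ← ih]
    simp only [Nat.add_sub_cancel]
    omega

/-- The retractions correspond to pairs `(m, I)`: the degree recovers `m` and the image recovers
`I`. -/
theorem ncard_iUnion_B {r : ℕ} (hr : 2 ≤ r) (hrn : r < n) :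
    (⋃ m ∈ Set.Icc (r + 1) n, B n r m).ncard + 1 = n.choose r := by
  let F : Finset (Σ _ : ℕ, Finset ℕ) :=
    (Finset.Icc (r + 1) n).sigma fun m => Finset.powersetCard (r - 1) (Finset.Icc 2 m)
  have hF : ∀ p ∈ F, r + 1 ≤ p.1 ∧ p.1 ≤ n ∧ p.2 ⊆ Finset.Icc 2 p.1 ∧ p.2.card = r - 1 := by
    intro p hp
    simpa [F, and_assoc] using hp
  have hEq : (⋃ m ∈ Set.Icc (r + 1) n, B n r m) =
      (fun p : Σ _ : ℕ, Finset ℕ => idem n p.1 p.2) '' (F : Set (Σ _ : ℕ, Finset ℕ)) := by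
    ext α
    simp only [Set.mem_iUnion, Set.mem_image, Finset.mem_coe, exists_prop]
    constructor
    · rintro ⟨m, hm, hα⟩
      rw [Set.mem_Icc] at hm
      rw [B_eq hr (by omega) hm.2] at hα
      obtain ⟨I, hI, rfl⟩ := hα
      exact ⟨⟨m, I⟩, Finset.mem_sigma.2 ⟨Finset.mem_Icc.2 hm, hI⟩, rfl⟩
    · rintro ⟨p, hp, rfl⟩
      obtain ⟨h1, h2, h3, h4⟩ := hF p hp
      refine ⟨p.1, Set.mem_Icc.2 ⟨h1, h2⟩, ?_⟩
      rw [B_eq hr (by omega) h2]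
      exact ⟨p.2, Finset.mem_coe.2 (Finset.mem_powersetCard.2 ⟨h3, h4⟩), rfl⟩
  have hB : ∀ p ∈ F, idem n p.1 p.2 ∈ B n r p.1 := by
    intro p hp
    obtain ⟨h1, h2, h3, h4⟩ := hF p hp
    rw [B_eq hr (by omega) h2]
    exact ⟨p.2, Finset.mem_coe.2 (Finset.mem_powersetCard.2 ⟨h3, h4⟩), rfl⟩
  have hinj : Set.InjOn (fun p : Σ _ : ℕ, Finset ℕ => idem n p.1 p.2)
      (F : Set (Σ _ : ℕ, Finset ℕ)) := by
    rintro ⟨m, I⟩ hp ⟨m', I'⟩ hp' heq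
    simp only at heq
    obtain rfl : m = m' := by
      have h := (hB _ hp).2.2.2
      have h' := (hB _ hp').2.2.2
      simp only at h h'
      rw [← h, ← h', heq]
    obtain ⟨h1, h2, h3, h4⟩ := hF _ hp
    obtain ⟨-, -, h3', h4'⟩ := hF _ hp'
    have himg := congrArg img heq
    simp only at h1 h2 h3 h3'
    rw [img_idem h3 h2 (by omega), img_idem h3' h2 (by omega)] at himg
    have n1 : ∀ J ⊆ Finset.Icc 2 m, 1 ∉ J := fun J hJ h => by
      have := Finset.mem_Icc.1 (hJ h); omega
    have : I = I' := by
      rw [← Finset.erase_insert (n1 I h3), himg, Finset.erase_insert (n1 I' h3')]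
    rw [this]
  rw [hEq, hinj.ncard_image, Set.ncard_coe_finset, Finset.card_sigma,
    ← sum_choose_add_one (by omega) hrn.le]
  congr 1
  apply Finset.sum_congr rfl
  intro m _
  rw [Finset.card_powersetCard, Nat.card_Icc]
  congr 1

theorem ncard_C {r : ℕ} (hr : 2 ≤ r) (hrn : r < n) :
    (C n r).ncard + 2 = n.choose r + r := by
  have hrho : {α | ∃ m ∈ Set.Icc 2 r, α = rho n m} = rho n '' Set.Icc 2 r := by
    ext α
    constructor
    · rintro ⟨m, hm, rfl⟩; exact ⟨m, hm, rfl⟩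
    · rintro ⟨m, hm, rfl⟩; exact ⟨m, hm, rfl⟩
  have hinj : Set.InjOn (rho n) (Set.Icc 2 r) := by
    have key : ∀ m m', 2 ≤ m → m < m' → m' ≤ r → rho n m ≠ rho n m' := by
      intro m m' h1 h2 h3 heq
      have := congrArg (fun α => val α m') heq
      rw [val_rho _ (by omega) (by omega), val_rho _ (by omega) (by omega), if_neg (by omega),
        if_pos le_rfl] at this
      omega
    intro m hm m' hm' heq
    rw [Set.mem_Icc] at hm hm'
    rcases lt_trichotomy m m' with hlt | hlt | hlt
    · exact (key m m' hm.1 hlt hm'.2 heq).elim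
    · exact hlt
    · exact (key m' m hm'.1 hlt hm.2 heq.symm).elim
  have hcard : (rho n '' Set.Icc 2 r).ncard = r - 1 := by
    rw [hinj.ncard_image, ← Finset.coe_Icc, Set.ncard_coe_finset, Nat.card_Icc]
    omega
  have hU := ncard_iUnion_B hr hrn
  unfold C
  rw [hrho, Set.ncard_union_eq, hcard]
  · omega
  -- `rho n m` drops at `m + 1 ≤ r + 1`, so its degree is too small for the union.
  · rw [Set.disjoint_left]
    rintro _ hα ⟨m, hm, rfl⟩
    simp only [Set.mem_iUnion] at hα
    obtain ⟨m', hm', hα⟩ := hα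
    rw [Set.mem_Icc] at hm hm'
    obtain ⟨-, h2, -⟩ := opd_spec (rho n m)
    rw [hα.2.2.2, orderPreservingUpTo_iff] at h2
    have := h2 m (m + 1) (by omega) (by omega) (by omega) (by omega)
    rw [val_rho _ (by omega) (by omega), val_rho _ (by omega) (by omega), if_pos le_rfl,
      if_neg (by omega)] at this
    omega

theorem rank_eq_of_le {A S : Set (T n)} (hA : IsGeneratingSet A S)
    (hle : ∀ A', IsGeneratingSet A' S → A.ncard ≤ A'.ncard) : rank S = A.ncard := by
  apply le_antisymm
  · exact Nat.sInf_le ⟨A, hA, rfl⟩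
  · refine le_csInf ⟨_, A, hA, rfl⟩ ?_
    rintro k ⟨A', hA', rfl⟩
    exact hle A' hA'

theorem rank_ORD_eq_ncard {r : ℕ} (hr : 3 ≤ r) (hrn : r < n) :
    rank (ORD n r) = (C n r ∪ G n r).ncard := by
  refine rank_eq_of_le (isGeneratingSet hr hrn) fun A' hA' => ?_
  rw [ncard_C_union_G hr hrn]
  exact le_ncard_of_isGeneratingSet hr hrn hA'

theorem rank_ORD {r : ℕ} (hr : 3 ≤ r) (hrn : r < n) :
    rank (ORD n r) = n.choose r + n + r - 5 := by
  have h := ncard_C (by omega : 2 ≤ r) hrn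
  have h' := Nat.choose_pos hrn.le
  rw [rank_ORD_eq_ncard hr hrn, ncard_C_union_G hr hrn]
  omega

/-! ### Adjoining the identity: the rank of `ORDn n` -/

/-- The identity transformation. -/
def one (n : ℕ) : T n := fun x => x

theorem val_one {x : ℕ} (h1 : 1 ≤ x) (h2 : x ≤ n) : val (one n) x = x := by
  rw [val_of_mem _ h1 h2]; rfl

theorem dec_one : Dec (one n) := fun _ h1 h2 => (val_one h1 h2).le

theorem one_mul' (α : T n) : one n * α = α := rfl

theorem mul_one' (α : T n) : α * one n = α := rfl

theorem img_one : img (one n) = Finset.Icc 1 n := by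
  ext y
  rw [mem_img, Finset.mem_Icc]
  constructor
  · rintro ⟨x, h1, h2, rfl⟩
    rw [val_one h1 h2]; exact ⟨h1, h2⟩
  · rintro ⟨h1, h2⟩
    exact ⟨y, h1, h2, val_one h1 h2⟩

theorem one_mem_ORDn : one n ∈ ORDn n := by
  refine mem_ORDn_iff.2 ⟨.inl fun x y z hx hxy hyz hz => .inl ?_, dec_one⟩
  rwa [val_one hx (by omega), val_one (by omega) (by omega)]

theorem img_subset (α : T n) : img α ⊆ Finset.Icc 1 n := by
  intro y hy
  obtain ⟨x, h1, h2, rfl⟩ := mem_img.1 hy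
  exact Finset.mem_Icc.2 ⟨one_le_val α h1 h2, val_le_top α h1 h2⟩

/-- The identity is the only order-decreasing permutation. -/
theorem eq_one_of_card {α : T n} (hd : Dec α) (h : n ≤ (img α).card) : α = one n := by
  have himg : img α = Finset.Icc 1 n :=
    Finset.eq_of_subset_of_card_le (img_subset α) (by rw [Nat.card_Icc]; omega)
  have hinj : Set.InjOn (val α) (Finset.Icc 1 n) := by
    apply Finset.injOn_of_card_image_eq
    change (img α).card = _
    rw [himg]
  apply ext_val
  intro x
  induction x using Nat.strong_induction_on with
  | _ x ih =>
    intro h1 h2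
    rw [val_one h1 h2]
    have h3 := hd x h1 h2
    by_contra hne
    have h4 := one_le_val α h1 h2
    -- If `x` moved down, its value would be a fixed point by induction, and injectivity would fail.
    have h5 := ih (val α x) (by omega) h4 (by omega)
    rw [val_one h4 (by omega)] at h5
    exact hne (hinj (by simp; omega) (by simp; omega) h5)

theorem ORDn_eq (hn : 1 ≤ n) : ORDn n = insert (one n) (ORD n (n - 1)) := by
  ext α
  rw [Set.mem_insert_iff]
  constructor
  · intro h
    by_cases hc : (img α).card ≤ n - 1
    · exact .inr ⟨h, by rwa [height_eq]⟩
    · exact .inl (eq_one_of_card (mem_ORDn_iff.1 h).2 (by omega))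
  · rintro (rfl | h)
    · exact one_mem_ORDn
    · exact h.1

theorem one_notMem_ORD (hn : 1 ≤ n) : one n ∉ ORD n (n - 1) := by
  intro h
  have := (mem_ORD_iff.1 h).2.2
  rw [img_one, Nat.card_Icc] at this
  omega

theorem closure_insert_one (A : Set (T n)) :
    (Subsemigroup.closure (insert (one n) A) : Set (T n)) =
      insert (one n) (Subsemigroup.closure A : Set (T n)) := by
  apply Set.Subset.antisymm
  · intro x hx
    induction hx using Subsemigroup.closure_induction with
    | mem x hx => exact hx.imp_right fun h => Subsemigroup.subset_closure h
    | mul x y _ _ ihx ihy =>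
      rcases ihx with rfl | ihx
      · rwa [one_mul']
      · rcases ihy with rfl | ihy
        · rw [mul_one']; exact .inr ihx
        · exact .inr (mul_mem ihx ihy)
  · rintro x (rfl | hx)
    · exact Subsemigroup.subset_closure (Set.mem_insert _ _)
    · exact Subsemigroup.closure_mono (Set.subset_insert _ _) hx

/-- The identity is the only element of height `n`, and the height of a product is at most that of
its left factor. So every generating set contains the identity, and without it generates `ORD n (n -
1)`. -/
theorem rank_ORDn_eq (hn : 4 ≤ n) : rank (ORDn n) = rank (ORD n (n - 1)) + 1 := by
  have hnot : ∀ A, IsGeneratingSet A (ORD n (n - 1)) → one n ∉ A := fun A hA h =>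
    one_notMem_ORD (n := n) (by omega) (hA.2 ▸ Subsemigroup.subset_closure h)
  have hgen := isGeneratingSet (n := n) (r := n - 1) (by omega) (by omega)
  have hrank := rank_ORD_eq_ncard (n := n) (r := n - 1) (by omega) (by omega)
  have hA : IsGeneratingSet (insert (one n) (C n (n - 1) ∪ G n (n - 1))) (ORDn n) := by
    refine ⟨Set.insert_nonempty _ _, ?_⟩
    rw [closure_insert_one, hgen.2, ← ORDn_eq (by omega)]
  rw [hrank, ← Set.ncard_insert_of_notMem (hnot _ hgen) (Set.toFinite _)]
  refine rank_eq_of_le hA fun A' hA' => ?_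
  have h1 : one n ∈ A' := by
    refine hA'.mem_of_prime one_mem_ORDn fun a ha b hb hab => .inl ?_
    have h2 := height_mul_le_left a b
    rw [hab, height_eq, height_eq, img_one, Nat.card_Icc] at h2
    exact eq_one_of_card (mem_ORDn_iff.1 ha).2 (by omega)
  have hins : insert (one n) (A' \ {one n}) = A' := by
    rw [Set.insert_sdiff_singleton, Set.insert_eq_of_mem h1]
  have hsub : A' \ {one n} ⊆ ORD n (n - 1) := by
    rintro x ⟨hx, hx1⟩
    have : x ∈ ORDn n := hA'.2 ▸ Subsemigroup.subset_closure hx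
    rw [ORDn_eq (by omega)] at this
    exact this.resolve_left hx1
  have hcl : (Subsemigroup.closure (A' \ {one n}) : Set (T n)) = ORD n (n - 1) := by
    have hle : Subsemigroup.closure (A' \ {one n}) ≤ ordSubsemigroup n (n - 1) :=
      (Subsemigroup.closure_le).2 hsub
    apply Set.Subset.antisymm hle
    intro x hx
    have h2 : x ∈ insert (one n) (Subsemigroup.closure (A' \ {one n}) : Set (T n)) := by
      rw [← closure_insert_one, hins, hA'.2]; exact hx.1
    exact h2.resolve_left fun h => one_notMem_ORD (n := n) (by omega) (h ▸ hx)
  have hne : (A' \ {one n}).Nonempty := by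
    rw [Set.nonempty_iff_ne_empty]
    intro h
    rw [h, Subsemigroup.closure_empty] at hcl
    obtain ⟨x, hx⟩ := hgen.1
    have : x ∈ ORD n (n - 1) := hgen.2 ▸ Subsemigroup.subset_closure hx
    rw [← hcl] at this
    exact this
  have hlow : rank (ORD n (n - 1)) ≤ (A' \ {one n}).ncard :=
    Nat.sInf_le ⟨_, ⟨hne, hcl⟩, rfl⟩
  rw [Set.ncard_insert_of_notMem (hnot _ hgen) (Set.toFinite _), ← hrank, ← hins,
    Set.ncard_insert_of_notMem (by simp) (Set.toFinite _)]
  omega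

end Transf

theorem theorem3p5 (n : ℕ) (hn : 4 ≤ n) :
    (∀ r : ℕ, 3 ≤ r → r ≤ n - 1 →
      Transf.IsMinimalGeneratingSet (Transf.C n r ∪ Transf.G n r) (Transf.ORD n r) ∧
      Transf.rank (Transf.ORD n r) = n.choose r + n + r - 5) ∧
    Transf.rank (Transf.ORDn n) = 3 * n - 5 := by
  refine ⟨fun r hr hrn => ⟨⟨Transf.isGeneratingSet hr (by omega), ?_⟩,
    Transf.rank_ORD hr (by omega)⟩, ?_⟩
  · exact (Transf.rank_ORD_eq_ncard hr (by omega)).symm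
  · rw [Transf.rank_ORDn_eq hn, Transf.rank_ORD (by omega) (by omega),
      Nat.choose_symm (by omega : 1 ≤ n), Nat.choose_one_right]
    omega
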